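/- Let $G$ be a second countable, unimodular, locally compact (Hausdorff) group with Haar measure $\mu$, and let $\mathcal H\neq\{0\}$ be a separable complex Hilbert space. Let $\pi$ be a discrete series $\sigma$-representation of $G$ on $\mathcal H$, where $\sigma:G\times G\to\mathbb T$. That is, $\pi(x)$ is a unitary operator on $\mathcal H$ for each $x\in G$, with $\pi(e)=I$ and $\pi(x)\pi(y)=\sigma(x,y)\pi(xy)$ for all $x,y\in G$; the functions $x\mapsto\langle\pi(x)f,g\rangle$ are Borel for all $f,g\in\mathcal H$; the only closed $\pi(G)$-invariant subspaces of $\mathcal H$ are $\{0\}$ and $\mathcal H$; and there is a dense subspace $\mathcal D\subseteq\mathcal H$ such that $x\mapsto\langle f,\pi(x)g\rangle$ is in $L^2(G)$ for all $f\in\mathcal H$, $g\in\mathcal D$. Let $\Gamma\subseteq G$ be a lattice, i.e. a discrete subgroup that has a left or right fundamental domain of finite measure. (A left fundamental domain is a Borel set $\Omega$ such that $G=\Gamma\Omega$ and the sets $\gamma\Omega$, $\gamma\in\Gamma$, are pairwise disjoint; a right one is defined with $\Omega\Gamma$ and $\Omega\gamma$ instead.) Then all left and right fundamental domains of $\Gamma$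 have the same finite measure, denoted $\mathrm{vol}(G/\Gamma)$, and there is a unique number $d_\pi>0$ (the formal dimension of $\pi$) such that $$\int_G\langle\pi(x)f_1,g_1\rangle\,\overline{\langle\pi(x)f_2,g_2\rangle}\,d\mu(x)=d_\pi^{-1}\langle f_1,f_2\rangle\,\overline{\langle g_1,g_2\rangle}\qquad\text{for all } f_1,f_2,g_1,g_2\in\mathcal H,$$ the integrands being integrable. Moreover: 1. If $\pi|_\Gamma$ admits a cyclic vector, i.e. some $g\in\mathcal H$ such that the linear span of $\{\pi(\gamma)g:\gamma\in\Gamma\}$ is dense in $\mathcal H$, then $\mathrm{vol}(G/\Gamma)\,d_\pi\le 1$. In particular, if $\pi|_\Gamma$ admits a frame vector, i.e. some $g\in\mathcal H$ for which there are $A,B>0$ with $A\|f\|^2\le\sum_{\gamma\in\Gamma}|\langle f,\pi(\gamma)g\rangle|^2\le B\|f\|^2$ for all $f\in\mathcal H$, then $\mathrm{vol}(G/\Gamma)\,d_\pi\le1$. 2. If $\pi|_\Gamma$ admits a Riesz vector, i.e. some $g\in\mathcal H$ for which there are $A,B>0$ such that for every $c\in\ell^2(\Gamma)$ the series $\sum_{\gamma}c_\gamma\pi(\gamma)g$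 converges unconditionally in $\mathcal H$ and $A\|c\|_2^2\le\big\|\sum_{\gamma}c_\gamma\pi(\gamma)g\big\|^2\le B\|c\|_2^2$, then $\mathrm{vol}(G/\Gamma)\,d_\pi\ge1$. 3. Suppose that $(\Gamma,\sigma)$ satisfies Kleppner's condition: every $\gamma_0\in\Gamma\setminus\{e\}$ such that $\sigma(\gamma_0,\gamma)=\sigma(\gamma,\gamma_0)$ for all $\gamma\in\Gamma$ commuting with $\gamma_0$ has an infinite conjugacy class in $\Gamma$. If the double commutant $\pi(\Gamma)''\subseteq\mathcal B(\mathcal H)$ admits a separating vector, i.e. some $g\in\mathcal H$ such that $T\in\pi(\Gamma)''$ and $Tg=0$ imply $T=0$, then $\mathrm{vol}(G/\Gamma)\,d_\pi\ge1$. -/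

import Mathlib

open MeasureTheory
open scoped ENNReal Pointwise

namespace LatticeOrbits

section Representations

variable {G : Type*} [Group G] [MeasurableSpace G]
variable {H : Type*} [NormedAddCommGroup H] [InnerProductSpace ℂ H] [CompleteSpace H]

/-- `π` is a projective unitary representation of `G` on `H` with cocycle `σ` (a `σ`-representation):
it is weakly Borel measurable, `π x π y = σ(x, y) π (x y)` and `π e = I`.
(For `H` separable and nonzero these conditions force `σ` to be a Borel measurable normalised
2-cocycle, uniquely determined by `π`.) -/
structure IsProjectiveRep (σ : G → G → Circle) (π : G → unitary (H →L[ℂ] H)) : Prop where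
  weakly_measurable : ∀ f g : H, Measurable fun x => inner ℂ g ((π x : H →L[ℂ] H) f)
  map_mul : ∀ x y : G,
    (π x : H →L[ℂ] H) * (π y : H →L[ℂ] H) = (σ x y : ℂ) • (π (x * y) : H →L[ℂ] H)
  map_one : π 1 = 1

/-- There is a norm dense subspace `D` of `H` such that the matrix coefficient `x ↦ ⟨f, π(x) g⟩`
is in `L²(G)` for all `f ∈ H` and `g ∈ D`.
(Mathlib's inner product is conjugate-linear in its first argument.) -/
def IsSquareIntegrable (μ : Measure G) (π : G → unitary (H →L[ℂ] H)) : Prop :=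
  ∃ D : Submodule ℂ H, Dense (D : Set H) ∧
    ∀ f : H, ∀ g ∈ D, MemLp (fun x => inner ℂ ((π x : H →L[ℂ] H) g) f) 2 μ

/-- The only closed `π(G)`-invariant subspaces are `{0}` and `H`. -/
def IsIrreducible (π : G → unitary (H →L[ℂ] H)) : Prop :=
  ∀ K : Submodule ℂ H, IsClosed (K : Set H) →
    (∀ x : G, ∀ v ∈ K, (π x : H →L[ℂ] H) v ∈ K) → K = ⊥ ∨ K = ⊤

/-- A discrete series `σ`-representation: square-integrable and irreducible. -/
structure IsDiscreteSeries (μ : Measure G) (σ : G → G → Circle)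
    (π : G → unitary (H →L[ℂ] H)) : Prop where
  isProjectiveRep : IsProjectiveRep σ π
  isSquareIntegrable : IsSquareIntegrable μ π
  isIrreducible : IsIrreducible π

/-- `d` is a formal dimension of `π`: `d > 0` and the orthogonality relations
`∫ ⟨π(x) f₁, g₁⟩ conj ⟨π(x) f₂, g₂⟩ dμ(x) = d⁻¹ ⟨f₁, f₂⟩ conj ⟨g₁, g₂⟩`
hold for all `f₁, f₂, g₁, g₂`, where `⟨·, ·⟩` is linear in the first argument, that is,
`⟨f, g⟩ = inner ℂ g f`. -/
def IsFormalDimension (μ : Measure G) (π : G → unitary (H →L[ℂ] H)) (d : ℝ) : Prop :=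
  0 < d ∧ ∀ f₁ f₂ g₁ g₂ : H,
    Integrable (fun x => inner ℂ g₁ ((π x : H →L[ℂ] H) f₁) *
      starRingEnd ℂ (inner ℂ g₂ ((π x : H →L[ℂ] H) f₂))) μ ∧
    ∫ x, inner ℂ g₁ ((π x : H →L[ℂ] H) f₁) *
      starRingEnd ℂ (inner ℂ g₂ ((π x : H →L[ℂ] H) f₂)) ∂μ =
        (d : ℂ)⁻¹ * inner ℂ f₂ f₁ * starRingEnd ℂ (inner ℂ g₂ g₁)

end Representations

section Lattices

variable {G : Type*} [Group G] [MeasurableSpace G]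

/-- A Borel set `Ω` with `G = Γ Ω` and `γ Ω ∩ γ' Ω = ∅` for `γ ≠ γ'` in `Γ`. -/
structure IsLeftFundamentalDomain (Γ : Subgroup G) (Ω : Set G) : Prop where
  measurableSet : MeasurableSet Ω
  covers : ∀ x : G, ∃ γ ∈ Γ, ∃ w ∈ Ω, x = γ * w
  disjoint : ∀ γ ∈ Γ, ∀ γ' ∈ Γ, γ ≠ γ' →
    Disjoint ((fun w => γ * w) '' Ω) ((fun w => γ' * w) '' Ω)

/-- A Borel set `Ω` with `G = Ω Γ` and `Ω γ ∩ Ω γ' = ∅` for `γ ≠ γ'` in `Γ`. -/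
structure IsRightFundamentalDomain (Γ : Subgroup G) (Ω : Set G) : Prop where
  measurableSet : MeasurableSet Ω
  covers : ∀ x : G, ∃ γ ∈ Γ, ∃ w ∈ Ω, x = w * γ
  disjoint : ∀ γ ∈ Γ, ∀ γ' ∈ Γ, γ ≠ γ' →
    Disjoint ((fun w => w * γ) '' Ω) ((fun w => w * γ') '' Ω)

/-- A lattice: a discrete subgroup with a left or right fundamental domain of finite measure. -/
structure IsLattice [TopologicalSpace G] (μ : Measure G) (Γ : Subgroup G) : Prop where
  discrete : DiscreteTopology Γ
  finite_covolume : ∃ Ω : Set G,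
    (IsLeftFundamentalDomain Γ Ω ∨ IsRightFundamentalDomain Γ Ω) ∧ μ Ω < ∞

/-- The real number `v ≥ 0` is the co-volume `vol(G/Γ)`: some left or right fundamental domain
exists, and all of them have measure `v`. -/
def IsCovolume (μ : Measure G) (Γ : Subgroup G) (v : ℝ) : Prop :=
  0 ≤ v ∧
  (∃ Ω : Set G, IsLeftFundamentalDomain Γ Ω ∨ IsRightFundamentalDomain Γ Ω) ∧
  ∀ Ω : Set G, IsLeftFundamentalDomain Γ Ω ∨ IsRightFundamentalDomain Γ Ω →
    μ Ω = ENNReal.ofReal v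

end Lattices

/-- Kleppner's condition for a group `Γ` and `σ : Γ × Γ → 𝕋`: every `σ`-regular element other than
the identity has an infinite conjugacy class, where `γ₀` is `σ`-regular if
`σ(γ₀, γ) = σ(γ, γ₀)` for all `γ` commuting with `γ₀`. -/
def KleppnerCondition {Γ : Type*} [Group Γ] (σ : Γ → Γ → Circle) : Prop :=
  ∀ γ₀ : Γ, γ₀ ≠ 1 → (∀ γ : Γ, γ₀ * γ = γ * γ₀ → σ γ₀ γ = σ γ γ₀) →
    {δ : Γ | ∃ γ : Γ, δ = γ * γ₀ * γ⁻¹}.Infinite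

section Orbits

variable {Γ : Type*}
variable {H : Type*} [NormedAddCommGroup H] [InnerProductSpace ℂ H] [CompleteSpace H]

/-- The closed linear span of the orbit `π(Γ) g` is `H`. -/
def IsCyclicVector (π : Γ → unitary (H →L[ℂ] H)) (g : H) : Prop :=
  (Submodule.span ℂ (Set.range fun γ => (π γ : H →L[ℂ] H) g)).topologicalClosure = ⊤

/-- The family `(π(γ) g)` is a frame:
`A ‖f‖² ≤ ∑ |⟨f, π(γ) g⟩|² ≤ B ‖f‖²` for all `f ∈ H`, for some `A, B > 0`. -/
def IsFrameVector (π : Γ → unitary (H →L[ℂ] H)) (g : H) : Prop :=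
  ∃ A B : ℝ, 0 < A ∧ 0 < B ∧ ∀ f : H,
    Summable (fun γ => ‖inner ℂ ((π γ : H →L[ℂ] H) g) f‖ ^ 2) ∧
    A * ‖f‖ ^ 2 ≤ ∑' γ, ‖inner ℂ ((π γ : H →L[ℂ] H) g) f‖ ^ 2 ∧
    ∑' γ, ‖inner ℂ ((π γ : H →L[ℂ] H) g) f‖ ^ 2 ≤ B * ‖f‖ ^ 2

/-- The family `(π(γ) g)` is a Riesz sequence:
`A ‖c‖² ≤ ‖∑ c_γ π(γ) g‖² ≤ B ‖c‖²` for all `c ∈ ℓ²(Γ)`, for some `A, B > 0`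
(the series converging unconditionally in norm). -/
def IsRieszVector (π : Γ → unitary (H →L[ℂ] H)) (g : H) : Prop :=
  ∃ A B : ℝ, 0 < A ∧ 0 < B ∧ ∀ c : lp (fun _ : Γ => ℂ) 2,
    Summable (fun γ => c γ • (π γ : H →L[ℂ] H) g) ∧
    A * ‖c‖ ^ 2 ≤ ‖∑' γ, c γ • (π γ : H →L[ℂ] H) g‖ ^ 2 ∧
    ‖∑' γ, c γ • (π γ : H →L[ℂ] H) g‖ ^ 2 ≤ B * ‖c‖ ^ 2

/-- The double commutant `π(Γ)''` in the bounded operators on `H`. -/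
def doubleCommutant (π : Γ → unitary (H →L[ℂ] H)) : Set (H →L[ℂ] H) :=
  Set.centralizer (Set.centralizer (Set.range fun γ => (π γ : H →L[ℂ] H)))

/-- `g` is separating for `π(Γ)''`: if `T ∈ π(Γ)''` and `T g = 0` then `T = 0`. -/
def IsSeparatingVector (π : Γ → unitary (H →L[ℂ] H)) (g : H) : Prop :=
  ∀ T ∈ doubleCommutant π, T g = 0 → T = 0

end Orbits

end LatticeOrbits

/-! Everything rests on one unfolding identity. For a left fundamental domain `Ω` and vectors `f`,
`g`, splitting the orthogonality relation over the translates `γΩ` gives `∫_Ω ∑_γ |⟨π(γ) g, π(x)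
f⟩|² dμ = d⁻¹ ‖f‖² ‖g‖²`. Take `f` of norm one. If `e` is a Parseval frame vector, the inner sum is
identically `1`, so `vol · d = ‖e‖² ≤ 1`. If `e` is a unit vector with Bessel bound one (for
instance with orthonormal orbit), the sum is at most `1`, so `1 ≤ vol · d`. It remains to produce
such an `e` from each hypothesis.

The tool is polar decomposition (`exists_isometric_intertwiner`): an injective bounded intertwiner
between `ℓ²(Γ)` and `H`, in either direction, yields an isometric one. A Riesz vector supplies an
injective synthesis operator. A cyclic vector should supply an injective analysis operator, but its
coefficients need not be square-summable. By the unfolding identity the coefficient operator is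
densely defined, and `exists_bessel_regularization` replaces `g` by a Bessel vector `A g`, with `A`
injective, self-adjoint and commuting with `π(Γ)`.

For a separating vector, let `Q` project onto the kernel of the synthesis operator of `A g`.
Convolution by `q = Q δ_1` extends to a bounded operator `T` in `π(Γ)''`: the unfolding identity
makes `‖v‖` monotone in the coefficients of `v`, much like a trace. Since `T` kills `g`, it
vanishes; Kleppner's condition makes the twisted regular representation a factor, which forces `q =
0`. So the synthesis operator is injective and the Riesz argument applies.

The formal dimension itself comes from Schur's lemma, unimodularity and polarization. -/

namespace LatticeOrbits

/-! ### The space `ℓ²(Γ)` and twisted translations. -/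

section SquareSummable

/-- The Hilbert space `ℓ²(Γ)`. -/
abbrev EllTwo (Γ : Type*) : Type _ := lp (fun _ : Γ => ℂ) 2

variable {Γ : Type*}

open Classical in
/-- The standard orthonormal basis vectors of `ℓ²(Γ)`. -/
noncomputable def delta (γ : Γ) : EllTwo Γ := lp.single 2 γ 1

open Classical in
theorem delta_apply (γ γ' : Γ) : delta γ γ' = if γ' = γ then 1 else 0 := by
  simp [delta, Pi.single_apply]

theorem delta_apply_self (γ : Γ) : delta γ γ = 1 := by simp [delta_apply]

theorem inner_delta_left (γ : Γ) (c : EllTwo Γ) : inner ℂ (delta γ) c = c γ := by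
  classical
  rw [delta]
  convert lp.inner_single_left (𝕜 := ℂ) (G := fun _ : Γ => ℂ) γ (1 : ℂ) c
  simp

theorem hasSum_delta (c : EllTwo Γ) : HasSum (fun γ => c γ • delta γ) c := by
  classical
  have := lp.hasSum_single (E := fun _ : Γ => ℂ) (p := 2) (by simp) c
  convert this using 2 with γ
  rw [delta, ← lp.single_smul]
  simp

theorem EllTwo.clm_ext {F : Type*} [NormedAddCommGroup F] [NormedSpace ℂ F]
    {A B : EllTwo Γ →L[ℂ] F} (h : ∀ γ, A (delta γ) = B (delta γ)) : A = B := by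
  ext c
  have hA := (hasSum_delta c).mapL A
  have hB := (hasSum_delta c).mapL B
  simp only [map_smul, h] at hA hB
  exact hA.unique hB

theorem EllTwo.hasSum_norm_sq (c : EllTwo Γ) : HasSum (fun γ => ‖c γ‖ ^ 2) (‖c‖ ^ 2) := by
  have := lp.hasSum_norm (E := fun _ : Γ => ℂ) (p := 2) (by simp) c
  simpa using this

theorem EllTwo.tsum_enorm_sq (c : EllTwo Γ) : ∑' γ, ‖c γ‖ₑ ^ 2 = ‖c‖ₑ ^ 2 := by
  have h := (EllTwo.hasSum_norm_sq c)
  have h2 := ENNReal.ofReal_tsum_of_nonneg (fun γ => sq_nonneg ‖c γ‖) h.summable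
  rw [h.tsum_eq] at h2
  simpa [ENNReal.ofReal_pow, ofReal_norm] using h2.symm

theorem memℓp_two_of_tsum_ne_top {c : Γ → ℂ} (h : ∑' γ, ‖c γ‖ₑ ^ 2 ≠ ∞) :
    Memℓp c 2 := by
  apply memℓp_gen
  have := ENNReal.summable_toReal h
  simpa using this

theorem orthonormal_delta : Orthonormal ℂ (delta : Γ → EllTwo Γ) := by
  classical
  rw [orthonormal_iff_ite]
  intro i j
  rw [inner_delta_left, delta_apply]

/-- The monomial unitary operator on `ℓ²(Γ)` with `δ_β ↦ u_β δ_{e β}`. -/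
noncomputable def monomialIsometry (e : Equiv.Perm Γ) (u : Γ → Circle) :
    EllTwo Γ ≃ₗᵢ[ℂ] EllTwo Γ := by
  have key : ∀ (e : Equiv.Perm Γ) (u : Γ → Circle) (c : EllTwo Γ),
      HasSum (fun γ => ‖(u γ : ℂ) * c (e γ)‖ ^ 2) (‖c‖ ^ 2) := by
    intro e u c
    have := e.hasSum_iff.2 (EllTwo.hasSum_norm_sq c)
    simpa [Function.comp_def, Circle.norm_coe] using this
  have mem : ∀ (e : Equiv.Perm Γ) (u : Γ → Circle) (c : EllTwo Γ),
      Memℓp (fun γ => (u γ : ℂ) * c (e γ)) 2 := by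
    intro e u c
    apply memℓp_gen
    simpa using (key e u c).summable
  exact
  { toFun := fun c => ⟨fun γ => (u (e.symm γ) : ℂ) * c (e.symm γ), mem e.symm (u ∘ e.symm) c⟩
    invFun := fun c => ⟨fun γ => ((u γ)⁻¹ : Circle) * c (e γ), mem e (u⁻¹) c⟩
    map_add' := fun a b => by ext γ; exact mul_add _ _ _
    map_smul' := fun a b => by ext γ; simp [mul_left_comm]
    left_inv := fun c => by ext γ; simp
    right_inv := fun c => by ext γ; simp
    norm_map' := fun c => by
      have h1 := key e.symm (u ∘ e.symm) c
      have h2 := EllTwo.hasSum_norm_sq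
        (⟨fun γ => (u (e.symm γ) : ℂ) * c (e.symm γ), mem e.symm (u ∘ e.symm) c⟩ : EllTwo Γ)
      have := h2.unique h1
      exact (pow_left_inj₀ (norm_nonneg _) (norm_nonneg _) two_ne_zero).1 this }

theorem monomialIsometry_apply (e : Equiv.Perm Γ) (u : Γ → Circle) (c : EllTwo Γ) (γ : Γ) :
    monomialIsometry e u c (e γ) = u γ * c γ := by
  change (u (e.symm (e γ)) : ℂ) * c (e.symm (e γ)) = _
  simp

theorem monomialIsometry_delta (e : Equiv.Perm Γ) (u : Γ → Circle) (γ : Γ) :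
    monomialIsometry e u (delta γ) = (u γ : ℂ) • delta (e γ) := by
  classical
  ext γ'
  obtain ⟨β, rfl⟩ := e.surjective γ'
  rw [monomialIsometry_apply]
  by_cases h : β = γ <;> simp [delta_apply, h]

variable [Group Γ]

/-- The twisted left regular representation, `δ_β ↦ σ(α, β) δ_{αβ}`. -/
noncomputable def leftReg (σ : Γ → Γ → Circle) (α : Γ) : EllTwo Γ ≃ₗᵢ[ℂ] EllTwo Γ :=
  monomialIsometry (Equiv.mulLeft α) (σ α)

/-- The twisted right translations, `δ_γ ↦ σ(γ, β) δ_{γβ}`. -/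
noncomputable def rightReg (σ : Γ → Γ → Circle) (β : Γ) : EllTwo Γ ≃ₗᵢ[ℂ] EllTwo Γ :=
  monomialIsometry (Equiv.mulRight β) (fun γ => σ γ β)

theorem leftReg_apply (σ : Γ → Γ → Circle) (α β : Γ) (c : EllTwo Γ) :
    leftReg σ α c (α * β) = σ α β * c β := monomialIsometry_apply (Equiv.mulLeft α) _ c β

theorem leftReg_delta (σ : Γ → Γ → Circle) (α β : Γ) :
    leftReg σ α (delta β) = (σ α β : ℂ) • delta (α * β) :=
  monomialIsometry_delta (Equiv.mulLeft α) _ β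

theorem rightReg_apply (σ : Γ → Γ → Circle) (β γ : Γ) (c : EllTwo Γ) :
    rightReg σ β c (γ * β) = σ γ β * c γ := monomialIsometry_apply (Equiv.mulRight β) _ c γ

theorem rightReg_delta (σ : Γ → Γ → Circle) (β γ : Γ) :
    rightReg σ β (delta γ) = (σ γ β : ℂ) • delta (γ * β) :=
  monomialIsometry_delta (Equiv.mulRight β) _ γ

end SquareSummable

/-! ### Algebra of projective unitary representations. -/

section ProjectiveRep

variable {Γ : Type*} [Group Γ]
variable {H : Type*} [NormedAddCommGroup H] [InnerProductSpace ℂ H] [CompleteSpace H]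

/-- The algebraic part of the definition of a `σ`-representation. -/
structure IsAlgProjectiveRep (σ : Γ → Γ → Circle) (π : Γ → unitary (H →L[ℂ] H)) : Prop where
  map_mul : ∀ x y : Γ,
    (π x : H →L[ℂ] H) * (π y : H →L[ℂ] H) = (σ x y : ℂ) • (π (x * y) : H →L[ℂ] H)
  map_one : π 1 = 1

theorem inner_unitary_unitary (u : unitary (H →L[ℂ] H)) (f g : H) :
    inner ℂ ((u : H →L[ℂ] H) f) ((u : H →L[ℂ] H) g) = inner ℂ f g := by
  rw [← ContinuousLinearMap.adjoint_inner_right, ← ContinuousLinearMap.star_eq_adjoint,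
    ← mul_apply_eq_comp, Unitary.coe_star_mul_self]
  simp

theorem norm_unitary_apply (u : unitary (H →L[ℂ] H)) (f : H) :
    ‖(u : H →L[ℂ] H) f‖ = ‖f‖ := by
  rw [@norm_eq_sqrt_re_inner ℂ, inner_unitary_unitary, ← @norm_eq_sqrt_re_inner ℂ]

namespace IsAlgProjectiveRep

variable {σ : Γ → Γ → Circle} {π : Γ → unitary (H →L[ℂ] H)} (hπ : IsAlgProjectiveRep σ π)
include hπ

theorem apply_apply (x y : Γ) (f : H) :
    (π x : H →L[ℂ] H) ((π y : H →L[ℂ] H) f) = (σ x y : ℂ) • (π (x * y) : H →L[ℂ] H) f := by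
  have := congrArg (fun T : H →L[ℂ] H => T f) (hπ.map_mul x y)
  simpa using this

theorem one_apply (f : H) : (π 1 : H →L[ℂ] H) f = f := by
  rw [hπ.map_one]; simp

theorem cocycle_one_right [Nontrivial H] (x : Γ) : σ x 1 = 1 := by
  obtain ⟨f, hf⟩ := exists_ne (0 : H)
  have h := hπ.apply_apply x 1 f
  rw [hπ.one_apply, mul_one] at h
  have hne : (π x : H →L[ℂ] H) f ≠ 0 := by
    rw [← norm_ne_zero_iff, norm_unitary_apply]; exact norm_ne_zero_iff.2 hf
  have : (1 - (σ x 1 : ℂ)) • (π x : H →L[ℂ] H) f = 0 := by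
    rw [sub_smul, one_smul, ← h, sub_self]
  have h2 := (smul_eq_zero.1 this).resolve_right hne
  exact Subtype.ext (sub_eq_zero.1 h2).symm

/-- Matrix coefficients of `π` transform under the adjoint with a unimodular factor. -/
theorem norm_inner_apply (x : Γ) (f g : H) :
    ‖inner ℂ f ((π x : H →L[ℂ] H) g)‖ = ‖inner ℂ ((π x⁻¹ : H →L[ℂ] H) f) g‖ := by
  rw [← inner_unitary_unitary (π x) ((π x⁻¹ : H →L[ℂ] H) f) g, hπ.apply_apply, mul_inv_cancel,
    hπ.one_apply, inner_smul_left, norm_mul]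
  simp [Circle.norm_coe]

theorem norm_inner_apply_apply (x y : Γ) (f g : H) :
    ‖inner ℂ ((π x : H →L[ℂ] H) f) ((π y : H →L[ℂ] H) g)‖ =
      ‖inner ℂ f ((π (x⁻¹ * y) : H →L[ℂ] H) g)‖ := by
  rw [← inner_unitary_unitary (π x) f, hπ.apply_apply, inner_smul_right, norm_mul]
  simp [Circle.norm_coe]

end IsAlgProjectiveRep

end ProjectiveRep

/-! ### Polar decomposition of intertwiners. -/

section Polar

variable {E F : Type*} [NormedAddCommGroup E] [InnerProductSpace ℂ E] [CompleteSpace E]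
  [NormedAddCommGroup F] [InnerProductSpace ℂ F] [CompleteSpace F]

/-- The isometric part of the polar decomposition of an injective intertwining operator is
again an intertwining operator. -/
theorem exists_isometric_intertwiner {ι : Type*} (C : E →L[ℂ] F) (hC : ∀ x, C x = 0 → x = 0)
    (U : ι → E ≃ₗᵢ[ℂ] E) (V : ι → F ≃ₗᵢ[ℂ] F) (h : ∀ i x, C (U i x) = V i (C x)) :
    ∃ W : E →ₗᵢ[ℂ] F, ∀ i x, W (U i x) = V i (W x) := by
  set S : E →L[ℂ] E := C.adjoint ∘L C with hS
  have hS0 : 0 ≤ S := (ContinuousLinearMap.nonneg_iff_isPositive S).2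
    (ContinuousLinearMap.isPositive_adjoint_comp_self C)
  set R : E →L[ℂ] E := CFC.sqrt S with hR
  have hR0 : 0 ≤ R := CFC.sqrt_nonneg S
  have hRsa : IsSelfAdjoint R := .of_nonneg hR0
  have hRR : R * R = S := CFC.sqrt_mul_sqrt_self S
  have hnorm : ∀ x, ‖R x‖ = ‖C x‖ := by
    intro x
    have h1 : inner ℂ (R x) (R x) = inner ℂ (C x) (C x) := by
      rw [← ContinuousLinearMap.adjoint_inner_right R, hRsa.adjoint_eq,
        ← ContinuousLinearMap.adjoint_inner_right C]
      exact congrArg (fun T : E →L[ℂ] E => inner ℂ x (T x)) hRR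
    rw [@norm_eq_sqrt_re_inner ℂ, h1, ← @norm_eq_sqrt_re_inner ℂ]
  have hRinj : ∀ x, R x = 0 → x = 0 := by
    intro x hx
    apply hC
    rw [← norm_eq_zero, ← hnorm, hx, norm_zero]
  -- `R = |C|` is self-adjoint and injective, so its range has trivial orthogonal complement.
  have hdense : DenseRange R := by
    have h1 : (LinearMap.range R.toLinearMap).topologicalClosure = ⊤ := by
      rw [Submodule.topologicalClosure_eq_top_iff, Submodule.eq_bot_iff]
      intro x hx
      apply hRinj
      apply ext_inner_left ℂ
      intro y
      rw [← ContinuousLinearMap.adjoint_inner_left R, hRsa.adjoint_eq, inner_zero_right]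
      exact (Submodule.mem_orthogonal _ _).1 hx _ ⟨y, rfl⟩
    exact (Submodule.dense_iff_topologicalClosure_eq_top).2 h1
  have hbound : ∀ x, ‖C.toLinearMap x‖ ≤ 1 * ‖R.toLinearMap x‖ := fun x => by
    simpa using (hnorm x).ge
  -- The polar isometry: `R x ↦ C x`, well defined and isometric because `‖R x‖ = ‖C x‖`.
  set W₀ : E →L[ℂ] F := C.toLinearMap.extendOfNorm R.toLinearMap with hW₀
  have hW : ∀ x, W₀ (R x) = C x := fun x =>
    LinearMap.extendOfNorm_eq (f := C.toLinearMap) (e := R.toLinearMap) hdense ⟨1, hbound⟩ x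
  have hWnorm : ∀ y, ‖W₀ y‖ = ‖y‖ := by
    intro y
    refine hdense.induction_on (p := fun y => ‖W₀ y‖ = ‖y‖) y ?_ ?_
    · exact isClosed_eq (by fun_prop) (by fun_prop)
    · intro x
      rw [hW, hnorm]
  refine ⟨⟨W₀.toLinearMap, hWnorm⟩, fun i y => ?_⟩
  -- As `U i` and `V i` are unitary, the adjoint intertwines too; hence `S` commutes with `U i`, and
  -- so does its square root by functional calculus.
  have hadj : ∀ y, C.adjoint (V i y) = U i (C.adjoint y) := by
    intro y
    apply ext_inner_right ℂ
    intro z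
    obtain ⟨z, rfl⟩ := (U i).surjective z
    rw [ContinuousLinearMap.adjoint_inner_left, h, LinearIsometryEquiv.inner_map_map,
      LinearIsometryEquiv.inner_map_map, ContinuousLinearMap.adjoint_inner_left]
  have hcomm : Commute S ((U i).toContinuousLinearEquiv : E →L[ℂ] E) := by
    ext x
    change C.adjoint (C (U i x)) = U i (C.adjoint (C x))
    rw [h, hadj]
  have hcommR : ∀ x, R (U i x) = U i (R x) := by
    intro x
    have : Commute R ((U i).toContinuousLinearEquiv : E →L[ℂ] E) := by
      rw [hR, CFC.sqrt]
      exact Commute.cfcₙ_nnreal hcomm _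
    exact congrArg (fun T : E →L[ℂ] E => T x) this
  change W₀ (U i y) = V i (W₀ y)
  refine hdense.induction_on (p := fun y => W₀ (U i y) = V i (W₀ y)) y ?_ ?_
  · exact isClosed_eq (by fun_prop) (by fun_prop)
  · intro x
    rw [← hcommR, hW, hW, h]

end Polar

/-! ### Regularizing an unbounded coefficient operator. -/

section Bessel

variable {Γ : Type*} [Group Γ]
variable {H : Type*} [NormedAddCommGroup H] [InnerProductSpace ℂ H] [CompleteSpace H]

/-- `v` is a Bessel vector for `π` if the synthesis operator `c ↦ ∑ c_γ π(γ) v` is bounded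
on `ℓ²(Γ)`. -/
def IsBesselVector (π : Γ → unitary (H →L[ℂ] H)) (v : H) : Prop :=
  ∃ D : EllTwo Γ →L[ℂ] H, ∀ γ, D (delta γ) = (π γ : H →L[ℂ] H) v

/-- The vectors `f` whose coefficients `⟨f, π(γ) g⟩` are square-summable. -/
def coefficientDomain (π : Γ → unitary (H →L[ℂ] H)) (g : H) : Set H :=
  {f | Memℓp (fun γ => inner ℂ ((π γ : H →L[ℂ] H) g) f) 2}

namespace IsAlgProjectiveRep

variable {σ : Γ → Γ → Circle} {π : Γ → unitary (H →L[ℂ] H)} (hπ : IsAlgProjectiveRep σ π)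
include hπ

theorem inner_mul_apply (γ β : Γ) (g f : H) :
    inner ℂ ((π (γ * β) : H →L[ℂ] H) g) ((π γ : H →L[ℂ] H) f) =
      σ γ β * inner ℂ ((π β : H →L[ℂ] H) g) f := by
  rw [← inner_unitary_unitary (π γ) ((π β : H →L[ℂ] H) g), hπ.apply_apply, inner_smul_left,
    ← mul_assoc, Complex.mul_conj, Complex.normSq_eq_norm_sq, Circle.norm_coe]
  simp

/-- With `C` the closed, densely defined operator `f ↦ (⟨π(γ) g, f⟩)_γ`, the choice is `A = (1 +
C*C)⁻¹`. To avoid unbounded operators it is realised as `ι ι*`, where `ι` projects the graph of `C`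
to `H`. -/
theorem exists_bessel_regularization (g : H) (hg : Dense (coefficientDomain π g)) :
    ∃ A : H →L[ℂ] H, IsSelfAdjoint A ∧
      (∀ γ f, A ((π γ : H →L[ℂ] H) f) = (π γ : H →L[ℂ] H) (A f)) ∧
      (∀ k, inner ℂ k (A k) = 0 → k = 0) ∧ IsBesselVector π (A g) := by
  -- The graph of the coefficient operator; it is cut out by continuous equations, hence closed.
  let K : Submodule ℂ (WithLp 2 (H × EllTwo Γ)) :=
    { carrier := {p | ∀ γ, p.snd γ = inner ℂ ((π γ : H →L[ℂ] H) g) p.fst}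
      zero_mem' := fun γ => by simp
      add_mem' := fun {a b} ha hb γ => by
        simp [← ha γ, ← hb γ]
      smul_mem' := fun c a ha γ => by
        simp [← ha γ] }
  have hKmem : ∀ p, p ∈ K ↔ ∀ γ, p.snd γ = inner ℂ ((π γ : H →L[ℂ] H) g) p.fst := fun p => Iff.rfl
  let fstL : WithLp 2 (H × EllTwo Γ) →L[ℂ] H := WithLp.fstL 2 ℂ H (EllTwo Γ)
  let sndL : WithLp 2 (H × EllTwo Γ) →L[ℂ] EllTwo Γ := WithLp.sndL 2 ℂ H (EllTwo Γ)
  have hfst : ∀ p, fstL p = p.fst := fun p => rfl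
  have hsnd : ∀ p, sndL p = p.snd := fun p => rfl
  have hKc : IsClosed (K : Set (WithLp 2 (H × EllTwo Γ))) := by
    have : (K : Set (WithLp 2 (H × EllTwo Γ))) =
        ⋂ γ, {p | inner ℂ (delta γ) (sndL p) = inner ℂ ((π γ : H →L[ℂ] H) g) (fstL p)} := by
      ext p
      simp [hKmem, inner_delta_left, hfst, hsnd]
    rw [this]
    exact isClosed_iInter fun γ => isClosed_eq (by fun_prop) (by fun_prop)
  have : CompleteSpace K := hKc.completeSpace_coe
  let ι : K →L[ℂ] H := fstL ∘L K.subtypeL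
  let T : K →L[ℂ] EllTwo Γ := sndL ∘L K.subtypeL
  have hcomm : ∀ γ f, (ι ∘L ι.adjoint) ((π γ : H →L[ℂ] H) f) =
      (π γ : H →L[ℂ] H) ((ι ∘L ι.adjoint) f) := by
    intro γ f
    -- The unitary `π(γ) ⊕ leftReg σ γ` preserves the graph, so `ι ι*` commutes with `π(γ)`.
    let u : WithLp 2 (H × EllTwo Γ) → WithLp 2 (H × EllTwo Γ) := fun p =>
      WithLp.toLp 2 ((π γ : H →L[ℂ] H) p.fst, leftReg σ γ p.snd)
    have hu : ∀ p, u p ∈ K ↔ p ∈ K := by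
      intro p
      rw [hKmem, hKmem, ← (Equiv.mulLeft γ).forall_congr_right]
      refine forall_congr' fun β => ?_
      change leftReg σ γ p.snd (γ * β) =
        inner ℂ ((π (γ * β) : H →L[ℂ] H) g) ((π γ : H →L[ℂ] H) p.fst) ↔ _
      rw [leftReg_apply, hπ.inner_mul_apply, mul_right_inj' (Circle.coe_ne_zero _)]
    have husurj : ∀ p, ∃ p', u p' = p := by
      intro p
      refine ⟨WithLp.toLp 2 (star (π γ : H →L[ℂ] H) p.fst, (leftReg σ γ).symm p.snd), ?_⟩
      have : (π γ : H →L[ℂ] H) (star (π γ : H →L[ℂ] H) p.fst) = p.fst := by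
        rw [← mul_apply_eq_comp, Unitary.mul_star_self_of_mem (π γ).2]; simp
      change WithLp.toLp 2 ((π γ : H →L[ℂ] H) (star (π γ : H →L[ℂ] H) p.fst),
        leftReg σ γ ((leftReg σ γ).symm p.snd)) = p
      rw [this, LinearIsometryEquiv.apply_symm_apply]
      rfl
    have huinner : ∀ p p', inner ℂ (u p) (u p') = inner ℂ p p' := by
      intro p p'
      simp only [u, WithLp.prod_inner_apply]
      simp [inner_unitary_unitary]
    let k := ι.adjoint f
    have hk : ι.adjoint ((π γ : H →L[ℂ] H) f) = ⟨u k, (hu k).2 k.2⟩ := by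
      apply ext_inner_right ℂ
      rintro ⟨k', hk'⟩
      obtain ⟨p, rfl⟩ := husurj k'
      have hp : p ∈ K := (hu p).1 hk'
      have h1 : inner ℂ (k : WithLp 2 (H × EllTwo Γ)) p = inner ℂ f p.fst :=
        ContinuousLinearMap.adjoint_inner_left ι ⟨p, hp⟩ f
      rw [ContinuousLinearMap.adjoint_inner_left, Submodule.coe_inner, huinner, h1]
      exact inner_unitary_unitary _ _ _
    change ι (ι.adjoint ((π γ : H →L[ℂ] H) f)) = _
    rw [hk]
    rfl
  refine ⟨ι ∘L ι.adjoint, ?_, hcomm, ?_, ι ∘L T.adjoint, ?_⟩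
  · exact (ContinuousLinearMap.isPositive_self_comp_adjoint ι).isSelfAdjoint
  · intro k hk
    have h1 : ι.adjoint k = 0 := by
      rw [← inner_self_eq_zero (𝕜 := ℂ), ContinuousLinearMap.adjoint_inner_left]
      exact hk
    apply hg.eq_zero_of_inner_left ℂ
    intro f hf
    let p : K := ⟨WithLp.toLp 2 (f, ⟨_, hf⟩), fun γ => rfl⟩
    have : inner ℂ (ι.adjoint k) p = inner ℂ k f := ContinuousLinearMap.adjoint_inner_left _ _ _
    rw [← this, h1, inner_zero_left]
  · intro γ
    -- This is the graph equation in dual form; applying `ι` shows that `ι T*` is the synthesis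
    -- operator of `A g`.
    have : T.adjoint (delta γ) = ι.adjoint ((π γ : H →L[ℂ] H) g) := by
      apply ext_inner_right ℂ
      intro k
      rw [ContinuousLinearMap.adjoint_inner_left, ContinuousLinearMap.adjoint_inner_left,
        inner_delta_left]
      exact k.2 γ
    rw [← hcomm, ContinuousLinearMap.comp_apply, this]
    rfl

end IsAlgProjectiveRep

end Bessel

/-! ### Factoriality under Kleppner's condition. -/

section InvariantSubspaces

theorem starProjection_apply_of_invariant {E : Type*} [NormedAddCommGroup E]
    [InnerProductSpace ℂ E] (K : Submodule ℂ E) [K.HasOrthogonalProjection] (U : E ≃ₗᵢ[ℂ] E)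
    (hU : ∀ x, U x ∈ K ↔ x ∈ K) (x : E) : K.starProjection (U x) = U (K.starProjection x) := by
  apply Submodule.eq_starProjection_of_mem_of_inner_eq_zero
  · exact (hU _).2 (Submodule.starProjection_apply_mem _ _)
  · intro w hw
    obtain ⟨w, rfl⟩ := U.surjective w
    rw [← map_sub, LinearIsometryEquiv.inner_map_map]
    exact Submodule.starProjection_inner_eq_zero _ _ ((hU w).1 hw)

variable {Γ : Type*} [Group Γ]

/-- Under Kleppner's condition, the twisted left regular representation is a factor
representation: there are no nontrivial closed two-sided invariant subspaces. -/
theorem KleppnerCondition.eq_bot_or_eq_top {σ : Γ → Γ → Circle} (hσ : KleppnerCondition σ)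
    (h1l : ∀ x, σ 1 x = 1) (h1r : ∀ x, σ x 1 = 1) (N : Submodule ℂ (EllTwo Γ))
    (hN : IsClosed (N : Set (EllTwo Γ))) (hl : ∀ γ c, leftReg σ γ c ∈ N ↔ c ∈ N)
    (hr : ∀ γ c, rightReg σ γ c ∈ N ↔ c ∈ N) : N = ⊥ ∨ N = ⊤ := by
  have : CompleteSpace N := hN.completeSpace_coe
  set e : EllTwo Γ := N.starProjection (delta 1) with he
  have hld : ∀ γ : Γ, leftReg σ γ (delta 1) = delta γ := fun γ => by
    rw [leftReg_delta, h1r, mul_one]; simp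
  have hrd : ∀ γ : Γ, rightReg σ γ (delta 1) = delta γ := fun γ => by
    rw [rightReg_delta, h1l, one_mul]; simp
  -- Both sides are the projection of `delta γ`, so `|e|` is constant on conjugacy classes.
  have hlr : ∀ γ, leftReg σ γ e = rightReg σ γ e := fun γ => by
    rw [he, ← starProjection_apply_of_invariant _ _ (hl γ),
      ← starProjection_apply_of_invariant _ _ (hr γ), hld, hrd]
  have hconj : ∀ γ α, (σ γ α : ℂ) * e α = σ (γ * α * γ⁻¹) γ * e (γ * α * γ⁻¹) := by
    intro γ α
    rw [← leftReg_apply, hlr, ← rightReg_apply, inv_mul_cancel_right]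
  -- A nonzero coefficient makes `α` a `σ`-regular element, while square-summability makes its class
  -- finite.
  have hsupp : ∀ α, α ≠ 1 → e α = 0 := by
    intro α hα
    by_contra hne
    have hreg : ∀ γ, α * γ = γ * α → σ α γ = σ γ α := by
      intro γ hγ
      have := hconj γ α
      rw [← hγ, mul_inv_cancel_right] at this
      exact (Subtype.ext (mul_right_cancel₀ hne this)).symm
    have hfin : {δ : Γ | ∃ γ : Γ, δ = γ * α * γ⁻¹}.Finite := by
      have hsum := (EllTwo.hasSum_norm_sq e).summable.tendsto_cofinite_zero
      have hev := hsum.eventually_lt_const (show (0 : ℝ) < ‖e α‖ ^ 2 by positivity)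
      rw [Filter.eventually_cofinite] at hev
      refine hev.subset ?_
      rintro _ ⟨γ, rfl⟩
      have := congrArg norm (hconj γ α)
      rw [norm_mul, norm_mul, Circle.norm_coe, Circle.norm_coe, one_mul, one_mul] at this
      simp [this]
    exact hσ α hα hreg hfin
  set t : ℂ := e 1 with ht
  have het : e = t • delta 1 := by
    classical
    ext α
    by_cases hα : α = 1
    · subst hα; simp [delta_apply, ht]
    · simp [delta_apply, hα, hsupp α hα]
  have hEd : ∀ γ, N.starProjection (delta γ) = t • delta γ := by
    intro γ
    rw [← hld γ, starProjection_apply_of_invariant _ _ (hl γ), ← he, het, map_smul]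
  have htt : t * t = t := by
    have h2 : N.starProjection e = e :=
      Submodule.starProjection_eq_self_iff.2 (Submodule.starProjection_apply_mem _ _)
    rw [het, map_smul, hEd, smul_smul] at h2
    have := congrArg (fun c : EllTwo Γ => c 1) h2
    simpa [delta_apply] using this
  have hE : N.starProjection = t • ContinuousLinearMap.id ℂ (EllTwo Γ) :=
    EllTwo.clm_ext fun γ => by rw [hEd]; rfl
  have h01 : t = 0 ∨ t = 1 := by
    by_cases h : t = 0
    · exact Or.inl h
    · exact Or.inr (mul_right_cancel₀ h (by rw [htt, one_mul]))
  rcases h01 with h | h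
  · left
    rw [Submodule.eq_bot_iff]
    intro x hx
    rw [← Submodule.starProjection_eq_self_iff.2 hx, hE, h]
    simp
  · right
    rw [Submodule.eq_top_iff']
    intro x
    rw [← Submodule.starProjection_eq_self_iff, hE, h]
    simp

end InvariantSubspaces

/-! ### Orthonormal orbits and Parseval frames from Bessel vectors. -/

section BesselConsequences

variable {Γ : Type*}
variable {H : Type*} [NormedAddCommGroup H] [InnerProductSpace ℂ H] [CompleteSpace H]
variable {π : Γ → unitary (H →L[ℂ] H)}

/-- The analysis operator is the adjoint of the synthesis operator. -/
theorem adjoint_synthesis_apply {v : H} {D : EllTwo Γ →L[ℂ] H}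
    (hD : ∀ γ, D (delta γ) = (π γ : H →L[ℂ] H) v) (f : H) (γ : Γ) :
    D.adjoint f γ = inner ℂ ((π γ : H →L[ℂ] H) v) f := by
  rw [← inner_delta_left, ContinuousLinearMap.adjoint_inner_right, hD]

/-- The submodule of Bessel vectors. -/
def besselSubmodule (π : Γ → unitary (H →L[ℂ] H)) : Submodule ℂ H where
  carrier := {v | IsBesselVector π v}
  zero_mem' := ⟨0, fun γ => by simp⟩
  add_mem' := by
    rintro a b ⟨A, hA⟩ ⟨B, hB⟩
    exact ⟨A + B, fun γ => by simp [hA, hB]⟩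
  smul_mem' := by
    rintro c a ⟨A, hA⟩
    exact ⟨c • A, fun γ => by simp [hA]⟩

theorem mem_besselSubmodule {v : H} : v ∈ besselSubmodule π ↔ IsBesselVector π v := Iff.rfl

theorem IsRieszVector.exists_synthesis {g : H} (hg : IsRieszVector π g) :
    ∃ D : EllTwo Γ →L[ℂ] H, (∀ γ, D (delta γ) = (π γ : H →L[ℂ] H) g) ∧
      ∀ c, D c = 0 → c = 0 := by
  classical
  obtain ⟨A, B, hA, hB, h⟩ := hg
  let D₀ : EllTwo Γ →ₗ[ℂ] H :=
    { toFun := fun c => ∑' γ, c γ • (π γ : H →L[ℂ] H) g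
      map_add' := fun a b => by
        rw [← (h a).1.tsum_add (h b).1]
        simp [add_smul]
      map_smul' := fun r a => by
        rw [RingHom.id_apply, ← (h a).1.tsum_const_smul r]
        simp [smul_smul] }
  have hbound : ∀ c, ‖D₀ c‖ ≤ √B * ‖c‖ := fun c => by
    refine (Real.le_sqrt_of_sq_le (h c).2.2).trans_eq ?_
    rw [Real.sqrt_mul hB.le, Real.sqrt_sq (norm_nonneg _)]
  refine ⟨D₀.mkContinuous _ hbound, fun γ => ?_, fun c hc => ?_⟩
  · change ∑' γ', (delta γ : EllTwo Γ) γ' • (π γ' : H →L[ℂ] H) g = _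
    rw [tsum_eq_single γ (fun γ' hne => by simp [delta_apply, hne]), delta_apply_self, one_smul]
  · have h1 := (h c).2.1
    change ∑' γ, c γ • (π γ : H →L[ℂ] H) g = 0 at hc
    rw [hc, norm_zero] at h1
    have h2 : ‖c‖ ^ 2 ≤ 0 := by
      by_contra hlt
      have := mul_pos hA (not_le.1 hlt)
      linarith
    have h3 : ‖c‖ = 0 := by nlinarith [norm_nonneg c]
    exact norm_eq_zero.1 h3

theorem IsFrameVector.isCyclicVector {g : H} (hg : IsFrameVector π g) : IsCyclicVector π g := by
  obtain ⟨A, B, hA, -, h⟩ := hg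
  rw [IsCyclicVector, Submodule.topologicalClosure_eq_top_iff, Submodule.eq_bot_iff]
  intro f hf
  have h0 : ∀ γ, inner ℂ ((π γ : H →L[ℂ] H) g) f = 0 := fun γ =>
    (Submodule.mem_orthogonal _ _).1 hf _ (Submodule.subset_span ⟨γ, rfl⟩)
  have h1 := (h f).2.1
  simp only [h0, norm_zero, ne_eq, OfNat.ofNat_ne_zero, not_false_eq_true, zero_pow,
    tsum_zero] at h1
  have h2 : ‖f‖ ^ 2 ≤ 0 := by
    by_contra hlt
    have := mul_pos hA (not_le.1 hlt)
    linarith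
  have h3 : ‖f‖ = 0 := by nlinarith [norm_nonneg f]
  exact norm_eq_zero.1 h3

theorem IsCyclicVector.eq_zero {g : H} (hg : IsCyclicVector π g) {f : H}
    (hf : ∀ γ, inner ℂ ((π γ : H →L[ℂ] H) g) f = 0) : f = 0 := by
  rw [IsCyclicVector, Submodule.topologicalClosure_eq_top_iff, Submodule.eq_bot_iff] at hg
  apply hg
  rw [Submodule.mem_orthogonal]
  intro u hu
  induction hu using Submodule.span_induction with
  | mem x hx => obtain ⟨γ, rfl⟩ := hx; exact hf γ
  | zero => simp
  | add x y _ _ hx hy => rw [inner_add_left, hx, hy, add_zero]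
  | smul a x _ hx => rw [inner_smul_left, hx, mul_zero]

namespace IsAlgProjectiveRep

variable [Group Γ] {σ : Γ → Γ → Circle} (hπ : IsAlgProjectiveRep σ π)
include hπ

theorem synthesis_leftReg {v : H} {D : EllTwo Γ →L[ℂ] H}
    (hD : ∀ γ, D (delta γ) = (π γ : H →L[ℂ] H) v) (γ : Γ) (c : EllTwo Γ) :
    D (leftReg σ γ c) = (π γ : H →L[ℂ] H) (D c) := by
  have : D ∘L ((leftReg σ γ).toContinuousLinearEquiv : EllTwo Γ →L[ℂ] EllTwo Γ) =
      (π γ : H →L[ℂ] H) ∘L D := EllTwo.clm_ext fun β => by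
    change D (leftReg σ γ (delta β)) = (π γ : H →L[ℂ] H) (D (delta β))
    rw [leftReg_delta, map_smul, hD, hD, hπ.apply_apply]
  exact congrArg (fun T : EllTwo Γ →L[ℂ] H => T c) this

/-- An injective bounded synthesis operator produces an orthonormal orbit. -/
theorem exists_bessel_unit_vector {v : H} {D : EllTwo Γ →L[ℂ] H}
    (hD : ∀ γ, D (delta γ) = (π γ : H →L[ℂ] H) v) (hinj : ∀ c, D c = 0 → c = 0) :
    ∃ e : H, ‖e‖ = 1 ∧ ∀ f, ∑' γ, ‖inner ℂ ((π γ : H →L[ℂ] H) e) f‖ₑ ^ 2 ≤ ‖f‖ₑ ^ 2 := by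
  obtain ⟨W, hW⟩ := exists_isometric_intertwiner D hinj (leftReg σ)
    (fun γ => Unitary.linearIsometryEquiv (π γ)) (fun γ c => hπ.synthesis_leftReg hD γ c)
  refine ⟨W (delta 1), by rw [W.norm_map, orthonormal_delta.1], fun f => ?_⟩
  have key : ∀ γ, ‖inner ℂ ((π γ : H →L[ℂ] H) (W (delta 1))) f‖ₑ =
      ‖(W.toContinuousLinearMap.adjoint f) γ‖ₑ := by
    intro γ
    have h1 : (π γ : H →L[ℂ] H) (W (delta 1)) = (σ γ 1 : ℂ) • W (delta γ) := by
      rw [← map_smul]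
      refine (hW γ (delta 1)).symm.trans ?_
      rw [leftReg_delta, mul_one]
    rw [h1, inner_smul_left, enorm_mul, ← inner_delta_left γ,
      ContinuousLinearMap.adjoint_inner_right]
    have : ‖(starRingEnd ℂ) (σ γ 1 : ℂ)‖ₑ = 1 := by
      rw [← ofReal_norm, RCLike.norm_conj, Circle.norm_coe, ENNReal.ofReal_one]
    rw [this, one_mul]
    rfl
  simp_rw [key]
  rw [EllTwo.tsum_enorm_sq]
  have hle : ‖W.toContinuousLinearMap.adjoint f‖ ≤ ‖f‖ := by
    refine (ContinuousLinearMap.le_opNorm _ _).trans ?_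
    rw [LinearIsometryEquiv.norm_map]
    exact mul_le_of_le_one_left (norm_nonneg _) W.norm_toContinuousLinearMap_le
  gcongr
  exact enorm_le_iff_norm_le.2 hle

/-- If the coefficients of a cyclic vector are densely defined, then there is a Parseval frame
vector. -/
theorem exists_parseval_vector {g : H} (hdom : Dense (coefficientDomain π g))
    (hg : IsCyclicVector π g) :
    ∃ e : H, ‖e‖ ≤ 1 ∧ ∀ f, ∑' γ, ‖inner ℂ ((π γ : H →L[ℂ] H) e) f‖ₑ ^ 2 = ‖f‖ₑ ^ 2 := by
  obtain ⟨A, hA, hcomm, hA0, D, hD⟩ := hπ.exists_bessel_regularization g hdom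
  -- The coefficients of `f` along `A g` are those of `A f` along `g`; cyclicity gives `A f = 0`.
  have hinj : ∀ f, D.adjoint f = 0 → f = 0 := by
    intro f hf
    apply hA0
    rw [hg.eq_zero (f := A f), inner_zero_right]
    intro γ
    rw [← ContinuousLinearMap.adjoint_inner_left, hA.adjoint_eq, hcomm,
      ← adjoint_synthesis_apply hD, hf]
    rfl
  have hC : ∀ γ f, D.adjoint (Unitary.linearIsometryEquiv (π γ) f) =
      leftReg σ γ (D.adjoint f) := by
    intro γ f
    ext δ
    obtain ⟨β, rfl⟩ := (Equiv.mulLeft γ).surjective δ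
    change D.adjoint ((π γ : H →L[ℂ] H) f) (γ * β) = leftReg σ γ (D.adjoint f) (γ * β)
    rw [leftReg_apply, adjoint_synthesis_apply hD, adjoint_synthesis_apply hD, hπ.inner_mul_apply]
  obtain ⟨W, hW⟩ := exists_isometric_intertwiner D.adjoint hinj
    (fun γ => Unitary.linearIsometryEquiv (π γ)) (leftReg σ) hC
  -- With this `e`, the coefficients of `f` along its orbit are those of `W f` up to phases, and `W`
  -- is isometric.
  set e : H := W.toContinuousLinearMap.adjoint (delta 1) with he
  have hin : ∀ f, inner ℂ e f = W f 1 := by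
    intro f
    rw [he, ContinuousLinearMap.adjoint_inner_left, inner_delta_left]
    rfl
  have key : ∀ γ f, ‖inner ℂ ((π γ : H →L[ℂ] H) e) f‖ₑ = ‖W f γ‖ₑ := by
    intro γ f
    obtain ⟨f, rfl⟩ := (Unitary.linearIsometryEquiv (π γ)).surjective f
    have h1 := leftReg_apply σ γ 1 (W f)
    rw [mul_one] at h1
    rw [hW, h1, enorm_mul]
    have : ‖(σ γ 1 : ℂ)‖ₑ = 1 := by
      rw [← ofReal_norm, Circle.norm_coe, ENNReal.ofReal_one]
    rw [this, one_mul, ← hin]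
    congr 1
    exact inner_unitary_unitary (π γ) e f
  refine ⟨e, ?_, fun f => ?_⟩
  -- `‖e‖² = |(W e)(1)| ≤ ‖W e‖ = ‖e‖`, so `‖e‖ ≤ 1`.
  · have h1 : ‖inner ℂ e e‖ ≤ ‖e‖ := by
      rw [hin]
      exact (lp.norm_apply_le_norm (by simp) _ _).trans_eq (W.norm_map e)
    rw [inner_self_eq_norm_sq_to_K] at h1
    have h2 : ‖e‖ ^ 2 ≤ ‖e‖ := by simpa using h1
    by_contra hlt
    nlinarith
  · simp_rw [key]
    rw [EllTwo.tsum_enorm_sq]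
    simp [enorm]

end IsAlgProjectiveRep

end BesselConsequences

/-! ### From separating vectors to injective synthesis. -/

section SeparatingVectors

variable {Γ : Type*} {H : Type*} [NormedAddCommGroup H] [InnerProductSpace ℂ H] [CompleteSpace H]
variable {π : Γ → unitary (H →L[ℂ] H)}

/-- The synthesis operator of a Bessel vector. -/
noncomputable def synthesis (v : besselSubmodule π) : EllTwo Γ →L[ℂ] H := v.2.choose

theorem synthesis_delta (v : besselSubmodule π) (γ : Γ) :
    synthesis v (delta γ) = (π γ : H →L[ℂ] H) v := v.2.choose_spec γ

theorem synthesis_eq {v : besselSubmodule π} {D : EllTwo Γ →L[ℂ] H}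
    (hD : ∀ γ, D (delta γ) = (π γ : H →L[ℂ] H) v) : synthesis v = D :=
  EllTwo.clm_ext fun γ => by rw [synthesis_delta, hD]

/-- `v ↦ ∑ q_γ π(γ) v` as a linear map on the Bessel vectors. -/
noncomputable def besselAction (π : Γ → unitary (H →L[ℂ] H)) (q : EllTwo Γ) :
    besselSubmodule π →ₗ[ℂ] H where
  toFun v := synthesis v q
  map_add' a b := by
    rw [synthesis_eq (D := synthesis a + synthesis b) fun γ => by simp [synthesis_delta]]
    rfl
  map_smul' r a := by
    rw [synthesis_eq (D := r • synthesis a) fun γ => by simp [synthesis_delta]]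
    rfl

theorem besselAction_apply (q : EllTwo Γ) (v : besselSubmodule π) :
    besselAction π q v = synthesis v q := rfl

variable [Group Γ] {σ : Γ → Γ → Circle}

namespace IsAlgProjectiveRep

variable (hπ : IsAlgProjectiveRep σ π)
include hπ

theorem cocycle_one_left [Nontrivial H] (x : Γ) : σ 1 x = 1 := by
  obtain ⟨f, hf⟩ := exists_ne (0 : H)
  have h := hπ.apply_apply 1 x f
  rw [hπ.one_apply, one_mul] at h
  have hne : (π x : H →L[ℂ] H) f ≠ 0 := by
    rw [← norm_ne_zero_iff, norm_unitary_apply]; exact norm_ne_zero_iff.2 hf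
  have : (1 - (σ 1 x : ℂ)) • (π x : H →L[ℂ] H) f = 0 := by
    rw [sub_smul, one_smul, ← h, sub_self]
  have h2 := (smul_eq_zero.1 this).resolve_right hne
  exact Subtype.ext (sub_eq_zero.1 h2).symm

/-- If `k` is orthogonal to all Bessel vectors, it is orthogonal to its own regularization `A k`,
and `⟨k, A k⟩ = 0` forces `k = 0`. -/
theorem dense_besselSubmodule (hdom : ∀ g, Dense (coefficientDomain π g)) :
    Dense (besselSubmodule π : Set H) := by
  rw [Submodule.dense_iff_topologicalClosure_eq_top, Submodule.topologicalClosure_eq_top_iff,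
    Submodule.eq_bot_iff]
  intro k hk
  obtain ⟨A, -, -, hA0, hb⟩ := hπ.exists_bessel_regularization k (hdom k)
  apply hA0
  rw [← inner_conj_symm, (Submodule.mem_orthogonal _ _).1 hk _ (mem_besselSubmodule.2 hb), map_zero]

/-- Right translation of coefficients amounts to moving the vector by `π(β)`. This makes the common
kernel of all synthesis operators right-invariant. -/
theorem synthesis_rightReg {v w : besselSubmodule π} (β : Γ)
    (hw : (w : H) = (π β : H →L[ℂ] H) v) (c : EllTwo Γ) :
    synthesis v (rightReg σ β c) = synthesis w c := by
  have : synthesis w =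
      synthesis v ∘L ((rightReg σ β).toContinuousLinearEquiv : EllTwo Γ →L[ℂ] EllTwo Γ) :=
    synthesis_eq fun γ => by
      change synthesis v (rightReg σ β (delta γ)) = _
      rw [rightReg_delta, map_smul, synthesis_delta, hw, hπ.apply_apply]
  rw [this]
  rfl

theorem apply_mem_besselSubmodule (β : Γ) {v : H} (hv : v ∈ besselSubmodule π) :
    (π β : H →L[ℂ] H) v ∈ besselSubmodule π := by
  refine ⟨synthesis ⟨v, hv⟩ ∘L
    ((rightReg σ β).toContinuousLinearEquiv : EllTwo Γ →L[ℂ] EllTwo Γ), fun γ => ?_⟩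
  change synthesis ⟨v, hv⟩ (rightReg σ β (delta γ)) = _
  rw [rightReg_delta, map_smul, synthesis_delta, hπ.apply_apply]

theorem exists_besselSubmodule_eq_apply (β : Γ) (v : besselSubmodule π) :
    ∃ w : besselSubmodule π, (v : H) = (π β : H →L[ℂ] H) w := by
  refine ⟨(σ β β⁻¹ : ℂ)⁻¹ • ⟨_, hπ.apply_mem_besselSubmodule β⁻¹ v.2⟩, ?_⟩
  rw [Submodule.coe_smul, map_smul, hπ.apply_apply, mul_inv_cancel, hπ.one_apply,
    inv_smul_smul₀ (Circle.coe_ne_zero _)]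

/-- Under Kleppner's condition, the extension of `π` to left convolution operators is faithful. -/
theorem eq_zero_of_besselAction_eq_zero [Nontrivial H] (hσ : KleppnerCondition σ)
    (hdense : Dense (besselSubmodule π : Set H)) {q : EllTwo Γ} (hq : besselAction π q = 0) :
    q = 0 := by
  -- A closed two-sided invariant subspace, hence trivial or everything; it cannot contain `delta
  -- 1`, since then every Bessel vector would vanish.
  let N : Submodule ℂ (EllTwo Γ) := ⨅ v : besselSubmodule π, (synthesis v).ker
  have hmem : ∀ c, c ∈ N ↔ ∀ v : besselSubmodule π, synthesis v c = 0 := fun c => by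
    simp [N, Submodule.mem_iInf]
  have hN : IsClosed (N : Set (EllTwo Γ)) := by
    have : (N : Set (EllTwo Γ)) = ⋂ v : besselSubmodule π, {c | synthesis v c = 0} := by
      ext c; simp [hmem]
    rw [this]
    exact isClosed_iInter fun v => isClosed_eq (by fun_prop) (by fun_prop)
  have hl : ∀ γ c, leftReg σ γ c ∈ N ↔ c ∈ N := by
    intro γ c
    rw [hmem, hmem]
    refine forall_congr' fun v => ?_
    rw [hπ.synthesis_leftReg (synthesis_delta v), ← norm_eq_zero, norm_unitary_apply, norm_eq_zero]
  have hr : ∀ γ c, rightReg σ γ c ∈ N ↔ c ∈ N := by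
    intro γ c
    rw [hmem, hmem]
    constructor
    · intro h w
      obtain ⟨v, hv⟩ := hπ.exists_besselSubmodule_eq_apply γ w
      rw [← hπ.synthesis_rightReg γ hv]
      exact h v
    · intro h v
      rw [hπ.synthesis_rightReg (w := ⟨_, hπ.apply_mem_besselSubmodule γ v.2⟩) γ rfl]
      exact h _
  rcases hσ.eq_bot_or_eq_top hπ.cocycle_one_left hπ.cocycle_one_right N hN hl hr with h | h
  · have : q ∈ N := (hmem q).2 fun v => by rw [← besselAction_apply, hq]; rfl
    rwa [h, Submodule.mem_bot] at this
  · exfalso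
    have hbot : besselSubmodule π = ⊥ := by
      rw [Submodule.eq_bot_iff]
      intro v hv
      have h1 : delta (1 : Γ) ∈ N := h ▸ Submodule.mem_top
      have h2 := (hmem _).1 h1 ⟨v, hv⟩
      rwa [synthesis_delta, hπ.one_apply] at h2
    rw [hbot, Submodule.dense_iff_topologicalClosure_eq_top] at hdense
    have h0 : (⊥ : Submodule ℂ H).topologicalClosure = ⊥ :=
      IsClosed.submodule_topologicalClosure_eq (by simp)
    rw [h0] at hdense
    exact bot_ne_top hdense

/-- Under Kleppner's condition, a separating vector for `π(Γ)''` yields a Bessel vector with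
injective synthesis operator, provided domination of Bessel coefficients implies domination
of norms. -/
theorem exists_injective_synthesis [Nontrivial H] (hσ : KleppnerCondition σ)
    (hdom : ∀ g, Dense (coefficientDomain π g))
    (hmono : ∀ v w : besselSubmodule π,
      (∀ f, ‖(synthesis w).adjoint f‖ ≤ ‖(synthesis v).adjoint f‖) → ‖(w : H)‖ ≤ ‖(v : H)‖)
    {g : H} (hg : IsSeparatingVector π g) :
    ∃ h : besselSubmodule π, ∀ c, synthesis h c = 0 → c = 0 := by
  obtain ⟨A, hA, hcomm, hA0, hAg⟩ := hπ.exists_bessel_regularization g (hdom g)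
  have hAinj : ∀ f, A f = 0 → f = 0 := fun f hf => hA0 f (by rw [hf, inner_zero_right])
  have hdense := hπ.dense_besselSubmodule hdom
  let h : besselSubmodule π := ⟨A g, hAg⟩
  refine ⟨h, ?_⟩
  let N : Submodule ℂ (EllTwo Γ) := (synthesis h).ker
  have hNmem : ∀ c, c ∈ N ↔ synthesis h c = 0 := fun c => Iff.rfl
  have hNc : IsClosed (N : Set (EllTwo Γ)) := (synthesis h).isClosed_ker
  have : CompleteSpace N := hNc.completeSpace_coe
  have hl : ∀ γ c, leftReg σ γ c ∈ N ↔ c ∈ N := by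
    intro γ c
    rw [hNmem, hNmem, hπ.synthesis_leftReg (synthesis_delta h), ← norm_eq_zero,
      norm_unitary_apply, norm_eq_zero]
  set Q : EllTwo Γ →L[ℂ] EllTwo Γ := N.starProjection with hQ
  set q : EllTwo Γ := Q (delta 1) with hq
  have hQd : ∀ γ, Q (delta γ) = leftReg σ γ q := by
    intro γ
    rw [hq, hQ, ← starProjection_apply_of_invariant _ _ (hl γ), leftReg_delta, mul_one,
      hπ.cocycle_one_right]
    simp
  have hw : ∀ v : besselSubmodule π, ∀ γ,
      (synthesis v ∘L Q) (delta γ) = (π γ : H →L[ℂ] H) (besselAction π q v) := by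
    intro v γ
    rw [ContinuousLinearMap.comp_apply, hQd, hπ.synthesis_leftReg (synthesis_delta v)]
    rfl
  -- The analysis operator of the image of `v` is `Q` after that of `v`; a projection contracts, so
  -- `hmono` gives norm bound `1`.
  have hbound : ∀ v : besselSubmodule π,
      ‖besselAction π q v‖ ≤ 1 * ‖(besselSubmodule π).subtype v‖ := by
    intro v
    rw [one_mul]
    refine hmono v ⟨besselAction π q v, _, hw v⟩ fun f => ?_
    rw [synthesis_eq (hw v), ContinuousLinearMap.adjoint_comp, ContinuousLinearMap.comp_apply]
    have hQs : Q.adjoint = Q := by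
      have := isSelfAdjoint_starProjection N
      exact this.adjoint_eq
    rw [hQs]
    exact Submodule.norm_starProjection_apply_le _ _
  have hdr : DenseRange (besselSubmodule π).subtype := by
    rw [DenseRange, Submodule.coe_subtype, Subtype.range_coe]
    exact hdense
  set T : H →L[ℂ] H := (besselAction π q).extendOfNorm (besselSubmodule π).subtype with hT
  have hTv : ∀ v : besselSubmodule π, T v = besselAction π q v := fun v =>
    LinearMap.extendOfNorm_eq (f := besselAction π q) (e := (besselSubmodule π).subtype) hdr
      ⟨1, hbound⟩ v
  -- For `X` in the commutant, `X ∘L synthesis v` is the synthesis operator of `X v`, so `T` and `X`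
  -- commute on the dense Bessel vectors.
  have hTcomm : ∀ X : H →L[ℂ] H, (∀ γ f, X ((π γ : H →L[ℂ] H) f) = (π γ : H →L[ℂ] H) (X f)) →
      ∀ f, T (X f) = X (T f) := by
    intro X hX f
    refine hdr.induction_on (p := fun f => T (X f) = X (T f)) f ?_ ?_
    · exact isClosed_eq (by fun_prop) (by fun_prop)
    · intro v
      have hXv : ∀ γ, (X ∘L synthesis v) (delta γ) = (π γ : H →L[ℂ] H) (X v) := fun γ => by
        rw [ContinuousLinearMap.comp_apply, synthesis_delta, hX]
      rw [Submodule.coe_subtype, hTv, besselAction_apply]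
      refine (hTv ⟨X v, _, hXv⟩).trans ?_
      rw [besselAction_apply, synthesis_eq hXv]
      rfl
  have hTmem : T ∈ doubleCommutant π := by
    rw [doubleCommutant, Set.mem_centralizer_iff]
    intro X hX
    ext f
    refine (hTcomm X (fun γ f => ?_) f).symm
    have := (Set.mem_centralizer_iff.1 hX) _ ⟨γ, rfl⟩
    exact (congrArg (fun S : H →L[ℂ] H => S f) this).symm
  -- `A (T g) = T (A g) = synthesis h q = 0` because `q ∈ N`; injectivity of `A` gives `T g = 0`.
  have hT0 : T = 0 := by
    refine hg T hTmem (hAinj _ ?_)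
    rw [← hTcomm A hcomm]
    refine (hTv h).trans ?_
    exact (hNmem _).1 (Submodule.starProjection_apply_mem _ _)
  have hq0 : q = 0 := by
    refine hπ.eq_zero_of_besselAction_eq_zero hσ hdense ?_
    ext v
    rw [← hTv, hT0]
    rfl
  have hQ0 : Q = 0 := EllTwo.clm_ext fun γ => by rw [hQd, hq0, map_zero]; rfl
  intro c hc
  rw [← Submodule.starProjection_eq_self_iff.2 ((hNmem c).2 hc), ← hQ, hQ0]
  rfl

end IsAlgProjectiveRep

end SeparatingVectors

/-! ### Unimodularity and the covolume. -/

section Covolume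

variable {G : Type*} [Group G] [TopologicalSpace G] [IsTopologicalGroup G]
    [LocallyCompactSpace G] [SecondCountableTopology G] [MeasurableSpace G] [BorelSpace G]
    (μ : Measure G) [μ.IsHaarMeasure] [μ.IsMulRightInvariant]

/-- A Haar measure on a unimodular group is inversion invariant. -/
theorem isInvInvariant_of_isMulRightInvariant : μ.IsInvInvariant := by
  set c := Measure.haarScalarFactor μ.inv μ
  have h1 : μ.inv = c • μ := Measure.isMulLeftInvariant_eq_smul μ.inv μ
  -- Inverting twice gives `c² = 1`; a compact neighbourhood of `1`, of positive finite measure,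
  -- lets the scalars be compared.
  have h2 : μ = c • c • μ := by
    have h3 : (c • μ).inv = c • μ.inv := by
      rw [Measure.inv, Measure.inv, Measure.map_smul]
    calc μ = μ.inv.inv := (Measure.inv_inv μ).symm
      _ = c • c • μ := by rw [h1, h3, h1]
  obtain ⟨K, hK, hK1⟩ := exists_compact_mem_nhds (1 : G)
  have h0 : μ K ≠ 0 := (Measure.measure_pos_of_mem_nhds μ hK1).ne'
  have htop : μ K ≠ ∞ := hK.measure_lt_top.ne
  have h4 : μ K = (c * c : NNReal) * μ K := by
    conv_lhs => rw [h2]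
    rw [smul_smul]
    rfl
  have h5 : (c * c : NNReal) = 1 := by
    have h6 : ((c * c : NNReal) : ℝ≥0∞) * μ K = 1 * μ K := by rw [← h4, one_mul]
    exact_mod_cast (ENNReal.mul_left_inj h0 htop).1 h6
  have h7 : c = 1 := by
    have : c ^ 2 = 1 := by rw [sq, h5]
    exact (pow_eq_one_iff_of_nonneg (zero_le (a := c)) two_ne_zero).1 this
  exact ⟨by rw [h1, h7, one_smul]⟩

variable {Γ : Subgroup G}

omit [IsTopologicalGroup G] [LocallyCompactSpace G] [BorelSpace G] in
theorem IsLattice.countable [T2Space G] {μ : Measure G} (hΓ : IsLattice μ Γ) : Countable Γ := by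
  have := hΓ.discrete
  exact TopologicalSpace.separableSpace_iff_countable.1 inferInstance

omit [TopologicalSpace G] [IsTopologicalGroup G]
    [LocallyCompactSpace G] [SecondCountableTopology G] [BorelSpace G] [μ.IsHaarMeasure]
    [μ.IsMulRightInvariant] in
theorem IsLeftFundamentalDomain.isFundamentalDomain {Ω : Set G}
    (hΩ : IsLeftFundamentalDomain Γ Ω) : IsFundamentalDomain Γ Ω μ where
  nullMeasurableSet := hΩ.measurableSet.nullMeasurableSet
  ae_covers := by
    refine Filter.Eventually.of_forall fun x => ?_
    obtain ⟨γ, hγ, w, hw, rfl⟩ := hΩ.covers x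
    exact ⟨⟨γ⁻¹, Γ.inv_mem hγ⟩, by simpa [Subgroup.smul_def] using hw⟩
  aedisjoint := fun γ γ' hne =>
    (hΩ.disjoint γ γ.2 γ' γ'.2 fun h => hne (Subtype.ext h)).aedisjoint

omit [LocallyCompactSpace G] [SecondCountableTopology G] in
theorem IsRightFundamentalDomain.inv {Ω : Set G} (hΩ : IsRightFundamentalDomain Γ Ω) :
    IsLeftFundamentalDomain Γ Ω⁻¹ where
  measurableSet := hΩ.measurableSet.inv
  covers := fun x => by
    obtain ⟨γ, hγ, w, hw, h⟩ := hΩ.covers x⁻¹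
    exact ⟨γ⁻¹, Γ.inv_mem hγ, w⁻¹, by simpa using hw, by rw [← mul_inv_rev, ← h, inv_inv]⟩
  disjoint := fun γ hγ γ' hγ' hne => by
    have := hΩ.disjoint γ⁻¹ (Γ.inv_mem hγ) γ'⁻¹ (Γ.inv_mem hγ') (fun h => hne (inv_injective h))
    rw [Set.disjoint_left] at this ⊢
    rintro _ ⟨w, hw, rfl⟩ ⟨w', hw', h⟩
    refine this ⟨w⁻¹, hw, rfl⟩ ⟨w'⁻¹, hw', ?_⟩
    have h' := congrArg (fun z => z⁻¹) h
    simpa using h'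

/-- Inversion turns right domains into left ones and preserves `μ`, so only left domains need
attention. -/
theorem exists_isLeftFundamentalDomain_of_or {Ω : Set G}
    (hΩ : IsLeftFundamentalDomain Γ Ω ∨ IsRightFundamentalDomain Γ Ω) :
    ∃ Ω', IsLeftFundamentalDomain Γ Ω' ∧ μ Ω' = μ Ω := by
  rcases hΩ with h | h
  · exact ⟨Ω, h, rfl⟩
  · have := isInvInvariant_of_isMulRightInvariant μ
    exact ⟨Ω⁻¹, h.inv, Measure.measure_inv μ Ω⟩

theorem IsLattice.existsUnique_covolume [T2Space G] (hΓ : IsLattice μ Γ) :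
    ∃! v : ℝ, IsCovolume μ Γ v := by
  have := hΓ.countable
  obtain ⟨Ω, hΩ, hfin⟩ := hΓ.finite_covolume
  refine ⟨(μ Ω).toReal, ⟨ENNReal.toReal_nonneg, ⟨Ω, hΩ⟩, fun Ω' hΩ' => ?_⟩, ?_⟩
  · rw [ENNReal.ofReal_toReal hfin.ne]
    obtain ⟨Ω₁, h1, h1'⟩ := exists_isLeftFundamentalDomain_of_or μ hΩ
    obtain ⟨Ω₂, h2, h2'⟩ := exists_isLeftFundamentalDomain_of_or μ hΩ'
    rw [← h1', ← h2']
    exact (h2.isFundamentalDomain μ).measure_eq (h1.isFundamentalDomain μ)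
  · rintro v ⟨hv, -, h⟩
    rw [h Ω hΩ, ENNReal.toReal_ofReal hv]

theorem IsCovolume.exists_isLeftFundamentalDomain {v : ℝ} (hv : IsCovolume μ Γ v) :
    ∃ Ω, IsLeftFundamentalDomain Γ Ω ∧ μ Ω = ENNReal.ofReal v := by
  obtain ⟨-, ⟨Ω, hΩ⟩, h⟩ := hv
  obtain ⟨Ω', h1, h2⟩ := exists_isLeftFundamentalDomain_of_or μ hΩ
  exact ⟨Ω', h1, h2.trans (h Ω hΩ)⟩

end Covolume

/-! ### Unfolding over a fundamental domain. -/

section Periodization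

variable {G : Type*} [Group G] [MeasurableSpace G] [MeasurableMul G]
  {μ : Measure G} [μ.IsMulLeftInvariant] {Γ : Subgroup G}
variable {H : Type*} [NormedAddCommGroup H] [InnerProductSpace ℂ H] [CompleteSpace H]
variable {σ : G → G → Circle} {π : G → unitary (H →L[ℂ] H)} {d : ℝ}

omit [MeasurableMul G] in
theorem IsProjectiveRep.isAlgProjectiveRep (hπ : IsProjectiveRep σ π) : IsAlgProjectiveRep σ π :=
  ⟨hπ.map_mul, hπ.map_one⟩

omit [MeasurableMul G] in
theorem IsProjectiveRep.isAlgProjectiveRep_subgroup (hπ : IsProjectiveRep σ π) (Γ : Subgroup G) :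
    IsAlgProjectiveRep (fun γ γ' : Γ => σ γ γ') (fun γ : Γ => π γ) :=
  ⟨fun x y => hπ.map_mul x y, hπ.map_one⟩

omit [Group G] [MeasurableMul G] [μ.IsMulLeftInvariant] in
theorem IsFormalDimension.lintegral_enorm_inner_sq (hd : IsFormalDimension μ π d) (f g : H) :
    ∫⁻ x, ‖inner ℂ g ((π x : H →L[ℂ] H) f)‖ₑ ^ 2 ∂μ =
      ENNReal.ofReal (d⁻¹ * ‖f‖ ^ 2 * ‖g‖ ^ 2) := by
  obtain ⟨-, h⟩ := hd
  obtain ⟨hi, he⟩ := h f f g g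
  have h1 : ∀ x, inner ℂ g ((π x : H →L[ℂ] H) f) *
      starRingEnd ℂ (inner ℂ g ((π x : H →L[ℂ] H) f)) =
        ((‖inner ℂ g ((π x : H →L[ℂ] H) f)‖ ^ 2 : ℝ) : ℂ) := fun x => by
    rw [Complex.mul_conj, Complex.normSq_eq_norm_sq]
  simp only [h1] at hi he
  rw [integral_complex_ofReal] at he
  have hi' : Integrable (fun x => ‖inner ℂ g ((π x : H →L[ℂ] H) f)‖ ^ 2) μ := hi.re
  have h2 : ∫ x, ‖inner ℂ g ((π x : H →L[ℂ] H) f)‖ ^ 2 ∂μ = d⁻¹ * ‖f‖ ^ 2 * ‖g‖ ^ 2 := by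
    rw [inner_self_eq_norm_sq_to_K, inner_self_eq_norm_sq_to_K] at he
    apply Complex.ofReal_injective
    rw [he]
    simp
  rw [← h2, ofReal_integral_eq_lintegral_ofReal hi' (Filter.Eventually.of_forall fun x => sq_nonneg _)]
  refine lintegral_congr fun x => ?_
  rw [ENNReal.ofReal_pow (norm_nonneg _), ofReal_norm]

omit [MeasurableMul G] in
theorem IsProjectiveRep.measurable_enorm_inner_sq (hπ : IsProjectiveRep σ π) (f g : H) :
    Measurable fun x => ‖inner ℂ g ((π x : H →L[ℂ] H) f)‖ₑ ^ 2 :=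
  (hπ.weakly_measurable f g).enorm.pow_const 2

/-- The unfolding identity: moving `π(γ)` across the inner product costs only a phase, so the sum
over `Γ` and the integral over `Ω` recombine into an integral over `G`. -/
theorem IsFormalDimension.setLIntegral_tsum (hd : IsFormalDimension μ π d)
    (hπ : IsProjectiveRep σ π) [Countable Γ] {Ω : Set G} (hΩ : IsLeftFundamentalDomain Γ Ω)
    (f g : H) :
    ∫⁻ x in Ω, ∑' γ : Γ, ‖inner ℂ ((π γ : H →L[ℂ] H) g) ((π x : H →L[ℂ] H) f)‖ₑ ^ 2 ∂μ =
      ENNReal.ofReal (d⁻¹ * ‖f‖ ^ 2 * ‖g‖ ^ 2) := by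
  rw [← hd.lintegral_enorm_inner_sq, (hΩ.isFundamentalDomain μ).lintegral_eq_tsum',
    lintegral_tsum fun γ => (hπ.measurable_enorm_inner_sq f _).aemeasurable]
  refine tsum_congr fun γ => lintegral_congr fun x => ?_
  rw [← ofReal_norm, ← ofReal_norm, hπ.isAlgProjectiveRep.norm_inner_apply_apply]
  rfl

omit [MeasurableMul G] in
theorem IsProjectiveRep.tsum_enorm_inner_sq_invariant (hπ : IsProjectiveRep σ π) (f g : H)
    (γ₀ : Γ) (x : G) :
    ∑' γ : Γ, ‖inner ℂ ((π γ : H →L[ℂ] H) g) ((π (γ₀ * x) : H →L[ℂ] H) f)‖ₑ ^ 2 =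
      ∑' γ : Γ, ‖inner ℂ ((π γ : H →L[ℂ] H) g) ((π x : H →L[ℂ] H) f)‖ₑ ^ 2 := by
  rw [← (Equiv.mulLeft γ₀).tsum_eq]
  refine tsum_congr fun γ => ?_
  rw [← ofReal_norm, ← ofReal_norm, hπ.isAlgProjectiveRep.norm_inner_apply_apply,
    hπ.isAlgProjectiveRep.norm_inner_apply_apply]
  simp [mul_assoc]

/-- Every coefficient operator of the restriction to a lattice is densely defined. -/
theorem IsFormalDimension.dense_coefficientDomain (hd : IsFormalDimension μ π d)
    (hπ : IsProjectiveRep σ π) [Countable Γ] {Ω : Set G} (hΩ : IsLeftFundamentalDomain Γ Ω)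
    (g : H) : Dense (coefficientDomain (fun γ : Γ => π γ) g) := by
  let S : Submodule ℂ H :=
    { carrier := coefficientDomain (fun γ : Γ => π γ) g
      zero_mem' := by
        change Memℓp _ 2
        simp only [inner_zero_right]
        exact zero_memℓp
      add_mem' := fun {a b} ha hb => by
        change Memℓp _ 2
        simp only [inner_add_right]
        exact Memℓp.add ha hb
      smul_mem' := fun c a ha => by
        change Memℓp _ 2
        simp only [inner_smul_right]
        exact Memℓp.const_mul ha c }
  change Dense (S : Set H)
  rw [Submodule.dense_iff_topologicalClosure_eq_top, Submodule.topologicalClosure_eq_top_iff,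
    Submodule.eq_bot_iff]
  intro k hk
  set F : G → ℝ≥0∞ := fun x =>
    ∑' γ : Γ, ‖inner ℂ ((π γ : H →L[ℂ] H) g) ((π x : H →L[ℂ] H) k)‖ₑ ^ 2 with hF
  have hFmeas : Measurable F := Measurable.tsum fun γ => hπ.measurable_enorm_inner_sq k _
  have hfd := hΩ.isFundamentalDomain μ
  -- `F` is integrable on `Ω`, hence finite a.e. there; `Γ`-invariance spreads this to all of `G`.
  have hnull : μ {x | F x = ∞} = 0 := by
    refine hfd.measure_zero_of_invariant _ (fun γ₀ => ?_) ?_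
    · ext x
      rw [Set.mem_smul_set_iff_inv_smul_mem]
      change F ((γ₀⁻¹ : Γ) * x) = ∞ ↔ F x = ∞
      simp only [hF, hπ.tsum_enorm_inner_sq_invariant]
    · have h1 : ∀ᵐ x ∂(μ.restrict Ω), F x < ∞ := by
        refine ae_lt_top hFmeas ?_
        rw [hd.setLIntegral_tsum hπ hΩ]
        exact ENNReal.ofReal_ne_top
      have hm : MeasurableSet {x | F x = ∞} := hFmeas (measurableSet_singleton ∞)
      rw [← Measure.restrict_apply hm]
      have h2 := ae_iff.1 h1
      simpa only [not_lt, top_le_iff] using h2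
  -- Almost every `π(x) k` lies in the coefficient domain, to which `k` is orthogonal; the
  -- orthogonality relation then gives `‖k‖⁴ = 0`.
  have hzero : ∫⁻ x, ‖inner ℂ k ((π x : H →L[ℂ] H) k)‖ₑ ^ 2 ∂μ = 0 := by
    rw [lintegral_eq_zero_iff (hπ.measurable_enorm_inner_sq k k)]
    have h1 : ∀ᵐ x ∂μ, F x ≠ ∞ := by
      rw [ae_iff]; simpa using hnull
    filter_upwards [h1] with x hx
    have hmem : (π x : H →L[ℂ] H) k ∈ S := memℓp_two_of_tsum_ne_top hx
    rw [← inner_conj_symm, (Submodule.mem_orthogonal _ _).1 hk _ hmem]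
    simp
  rw [hd.lintegral_enorm_inner_sq, ENNReal.ofReal_eq_zero] at hzero
  by_contra hk0
  have : 0 < ‖k‖ := norm_pos_iff.2 hk0
  have hd0 := hd.1
  have : 0 < d⁻¹ * ‖k‖ ^ 2 * ‖k‖ ^ 2 := by positivity
  linarith

theorem IsFormalDimension.covolume_mul_le_one [Nontrivial H] (hd : IsFormalDimension μ π d)
    (hπ : IsProjectiveRep σ π) [Countable Γ] {Ω : Set G} (hΩ : IsLeftFundamentalDomain Γ Ω)
    {v : ℝ} (hv : 0 ≤ v) (hΩv : μ Ω = ENNReal.ofReal v) {e : H} (he : ‖e‖ ≤ 1)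
    (hf : ∀ f, ∑' γ : Γ, ‖inner ℂ ((π γ : H →L[ℂ] H) e) f‖ₑ ^ 2 = ‖f‖ₑ ^ 2) : v * d ≤ 1 := by
  obtain ⟨f, hfn⟩ := exists_norm_eq H zero_le_one
  have h := hd.setLIntegral_tsum hπ hΩ f e
  have h1 : ∀ x, ‖(π x : H →L[ℂ] H) f‖ₑ = 1 := fun x => by
    rw [← ofReal_norm, norm_unitary_apply, hfn, ENNReal.ofReal_one]
  have hd0 := hd.1
  simp only [hf, h1, one_pow, lintegral_one, Measure.restrict_apply_univ, hΩv, hfn, mul_one] at h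
  rw [ENNReal.ofReal_eq_ofReal_iff hv (by positivity)] at h
  rw [h, mul_right_comm, inv_mul_cancel₀ hd0.ne', one_mul]
  exact pow_le_one₀ (norm_nonneg _) he

theorem IsFormalDimension.one_le_covolume_mul [Nontrivial H] (hd : IsFormalDimension μ π d)
    (hπ : IsProjectiveRep σ π) [Countable Γ] {Ω : Set G} (hΩ : IsLeftFundamentalDomain Γ Ω)
    {v : ℝ} (hv : 0 ≤ v) (hΩv : μ Ω = ENNReal.ofReal v) {e : H} (he : ‖e‖ = 1)
    (hf : ∀ f, ∑' γ : Γ, ‖inner ℂ ((π γ : H →L[ℂ] H) e) f‖ₑ ^ 2 ≤ ‖f‖ₑ ^ 2) : 1 ≤ v * d := by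
  obtain ⟨f, hfn⟩ := exists_norm_eq H zero_le_one
  have h := hd.setLIntegral_tsum hπ hΩ f e
  have h1 : ∀ x, ‖(π x : H →L[ℂ] H) f‖ₑ = 1 := fun x => by
    rw [← ofReal_norm, norm_unitary_apply, hfn, ENNReal.ofReal_one]
  have hd0 := hd.1
  have h2 := lintegral_mono (μ := μ.restrict Ω) fun x => hf ((π x : H →L[ℂ] H) f)
  rw [h] at h2
  simp only [h1, one_pow, lintegral_one, Measure.restrict_apply_univ, hΩv, hfn, he, mul_one] at h2
  rw [ENNReal.ofReal_le_ofReal_iff hv] at h2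
  have := mul_le_mul_of_nonneg_right h2 hd0.le
  rwa [inv_mul_cancel₀ hd0.ne'] at this

/-- For a fixed unit `f`, unfolding recovers `d⁻¹ ‖u‖²` as the integral over `Ω` of the squared norm
of the coefficients of `π(x) f` along `u`, and the integral is monotone. -/
theorem IsFormalDimension.norm_le_of_adjoint_synthesis_le [Nontrivial H]
    (hd : IsFormalDimension μ π d) (hπ : IsProjectiveRep σ π) [Countable Γ] {Ω : Set G}
    (hΩ : IsLeftFundamentalDomain Γ Ω) (v w : besselSubmodule fun γ : Γ => π γ)
    (h : ∀ f, ‖(synthesis w).adjoint f‖ ≤ ‖(synthesis v).adjoint f‖) : ‖(w : H)‖ ≤ ‖(v : H)‖ := by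
  obtain ⟨f, hfn⟩ := exists_norm_eq H zero_le_one
  have key : ∀ u : besselSubmodule fun γ : Γ => π γ,
      ∫⁻ x in Ω, ‖(synthesis u).adjoint ((π x : H →L[ℂ] H) f)‖ₑ ^ 2 ∂μ =
        ENNReal.ofReal (d⁻¹ * ‖(u : H)‖ ^ 2) := by
    intro u
    have h1 := hd.setLIntegral_tsum hπ hΩ f u
    rw [hfn, one_pow, mul_one] at h1
    rw [← h1]
    refine lintegral_congr fun x => ?_
    rw [← EllTwo.tsum_enorm_sq]
    refine tsum_congr fun γ => ?_
    rw [adjoint_synthesis_apply (synthesis_delta u)]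
  have h2 : ENNReal.ofReal (d⁻¹ * ‖(w : H)‖ ^ 2) ≤ ENNReal.ofReal (d⁻¹ * ‖(v : H)‖ ^ 2) := by
    rw [← key, ← key]
    refine lintegral_mono fun x => ?_
    have := h ((π x : H →L[ℂ] H) f)
    gcongr
    exact enorm_le_iff_norm_le.2 this
  have hd0 := hd.1
  rw [ENNReal.ofReal_le_ofReal_iff (by positivity), mul_le_mul_iff_right₀ (by positivity)] at h2
  exact (pow_le_pow_iff_left₀ (norm_nonneg _) (norm_nonneg _) two_ne_zero).1 h2

end Periodization

/-! ### Schur's lemma. -/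

section Schur

variable {G : Type*} {H : Type*} [NormedAddCommGroup H] [InnerProductSpace ℂ H] [CompleteSpace H]
  {π : G → unitary (H →L[ℂ] H)}

theorem IsIrreducible.eq_zero_or_eq_zero_of_mul_eq_zero (hi : IsIrreducible π) {P Q : H →L[ℂ] H}
    (hP : ∀ x, Commute P (π x : H →L[ℂ] H)) (hPQ : P * Q = 0) : P = 0 ∨ Q = 0 := by
  have hinv : ∀ x, ∀ v ∈ P.ker, (π x : H →L[ℂ] H) v ∈ P.ker := by
    intro x v hv
    change P ((π x : H →L[ℂ] H) v) = 0
    have h1 : P ((π x : H →L[ℂ] H) v) = (π x : H →L[ℂ] H) (P v) :=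
      congrArg (fun T : H →L[ℂ] H => T v) (hP x)
    have h2 : P v = 0 := hv
    rw [h1, h2, map_zero]
  rcases hi P.ker P.isClosed_ker hinv with h | h
  · right
    ext f
    have : Q f ∈ P.ker := congrArg (fun T : H →L[ℂ] H => T f) hPQ
    rwa [h] at this
  · left
    ext f
    have : f ∈ P.ker := h ▸ Submodule.mem_top
    exact this

/-- The positive and negative parts commute with `π` and have product zero, so one of them vanishes.
-/
theorem IsIrreducible.nonneg_or_nonpos (hi : IsIrreducible π) {T : H →L[ℂ] H}
    (hT : IsSelfAdjoint T) (hcomm : ∀ x, Commute T (π x : H →L[ℂ] H)) : 0 ≤ T ∨ 0 ≤ -T := by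
  have h1 : T⁺ - T⁻ = T := CFC.posPart_sub_negPart T hT
  have h2 : ∀ x, Commute T⁺ (π x : H →L[ℂ] H) := fun x => by
    rw [CFC.posPart_def]
    exact (hcomm x).cfcₙ_real _
  rcases hi.eq_zero_or_eq_zero_of_mul_eq_zero h2 (CFC.posPart_mul_negPart T) with h | h
  · right
    rw [← h1, h, zero_sub, neg_neg]
    exact CFC.negPart_nonneg T
  · left
    rw [← h1, h, sub_zero]
    exact CFC.posPart_nonneg T

/-- Schur's lemma for self-adjoint operators, in quadratic form. -/
theorem IsIrreducible.exists_re_inner_eq [Nontrivial H] (hi : IsIrreducible π) {S : H →L[ℂ] H}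
    (hS : IsSelfAdjoint S) (hcomm : ∀ x, Commute S (π x : H →L[ℂ] H)) :
    ∃ c : ℝ, ∀ f, (inner ℂ (S f) f).re = c * ‖f‖ ^ 2 := by
  obtain ⟨e, he⟩ := exists_norm_eq H zero_le_one
  set c := (inner ℂ (S e) e).re with hc
  have hself : ∀ f : H, (inner ℂ f f).re = ‖f‖ ^ 2 := fun f => by
    rw [inner_self_eq_norm_sq_to_K]
    norm_cast
  -- Each `S - t` has a definite sign, so no `t` can lie strictly between two values of the
  -- normalised quadratic form.
  have key : ∀ t : ℝ, (∀ f, t * ‖f‖ ^ 2 ≤ (inner ℂ (S f) f).re) ∨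
      (∀ f, (inner ℂ (S f) f).re ≤ t * ‖f‖ ^ 2) := by
    intro t
    have hval : ∀ f, (inner ℂ ((S - (t : ℂ) • (1 : H →L[ℂ] H)) f) f).re =
        (inner ℂ (S f) f).re - t * ‖f‖ ^ 2 := by
      intro f
      simp [hself, -inner_self_eq_norm_sq_to_K]
    have hsa : IsSelfAdjoint (S - (t : ℂ) • (1 : H →L[ℂ] H)) := by
      refine hS.sub ?_
      rw [IsSelfAdjoint, star_smul, star_one]
      simp
    have hcm : ∀ x, Commute (S - (t : ℂ) • (1 : H →L[ℂ] H)) (π x : H →L[ℂ] H) := fun x =>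
      (hcomm x).sub_left ((Commute.one_left _).smul_left _)
    rcases hi.nonneg_or_nonpos hsa hcm with h | h
    · left
      intro f
      have := ((ContinuousLinearMap.nonneg_iff_isPositive _).1 h).re_inner_nonneg_left f
      have h' := hval f
      simp only [RCLike.re_eq_complex_re] at this
      linarith
    · right
      intro f
      have := ((ContinuousLinearMap.nonneg_iff_isPositive _).1 h).re_inner_nonneg_left f
      have h' := hval f
      rw [_root_.neg_apply, inner_neg_left, map_neg] at this
      simp only [RCLike.re_eq_complex_re] at this
      linarith
  refine ⟨c, fun f => le_antisymm ?_ ?_⟩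
  · rw [← sub_nonneg]
    by_contra hlt
    have hf : 0 < ‖f‖ ^ 2 := by
      rcases eq_or_ne f 0 with rfl | hf
      · simp at hlt
      · have := norm_pos_iff.2 hf
        positivity
    obtain ⟨t, h1, h2⟩ := exists_between (show c < (inner ℂ (S f) f).re / ‖f‖ ^ 2 by
      rw [lt_div_iff₀ hf]; linarith)
    rw [lt_div_iff₀ hf] at h2
    rcases key t with h | h
    · have := h e
      rw [he, one_pow, mul_one] at this
      linarith
    · linarith [h f]
  · rw [← sub_nonneg]
    by_contra hlt
    have hf : 0 < ‖f‖ ^ 2 := by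
      rcases eq_or_ne f 0 with rfl | hf
      · simp at hlt
      · have := norm_pos_iff.2 hf
        positivity
    obtain ⟨t, h1, h2⟩ := exists_between (show (inner ℂ (S f) f).re / ‖f‖ ^ 2 < c by
      rw [div_lt_iff₀ hf]; linarith)
    rw [div_lt_iff₀ hf] at h1
    rcases key t with h | h
    · linarith [h f]
    · have := h e
      rw [he, one_pow, mul_one] at this
      linarith

end Schur

/-! ### Square-integrability of all matrix coefficients. -/

section Coefficients

variable {G : Type*} [Group G] [MeasurableSpace G] {μ : Measure G}
  {H : Type*} [NormedAddCommGroup H] [InnerProductSpace ℂ H] [CompleteSpace H]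
  {σ : G → G → Circle} {π : G → unitary (H →L[ℂ] H)}

omit [Group G] in
/-- The coefficient operator `f ↦ ⟨f, π(·) g⟩` is bounded into `L²` as soon as it is everywhere
defined. -/
theorem exists_coefficient_operator {g : H}
    (hg : ∀ f, MemLp (fun x => inner ℂ ((π x : H →L[ℂ] H) g) f) 2 μ) :
    ∃ V : H →L[ℂ] Lp ℂ 2 μ, ∀ f, V f = (hg f).toLp _ := by
  let V₀ : H →ₗ[ℂ] Lp ℂ 2 μ :=
    { toFun := fun f => (hg f).toLp _
      map_add' := fun a b => by
        rw [← MemLp.toLp_add]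
        congr 1
        ext x
        simp
      map_smul' := fun c a => by
        rw [RingHom.id_apply, ← MemLp.toLp_const_smul]
        congr 1
        ext x
        simp }
  -- Closed graph: an `L²` limit is an a.e. limit along a subsequence, while the coefficients
  -- converge pointwise.
  refine ⟨⟨V₀, V₀.continuous_of_seq_closed_graph fun u f y hu hy => ?_⟩, fun f => rfl⟩
  obtain ⟨φ, hφ, hae⟩ := (tendstoInMeasure_of_tendsto_Lp hy).exists_seq_tendsto_ae
  have h1 : ∀ᵐ x ∂μ, ∀ n, (V₀ (u n) : G → ℂ) x = inner ℂ ((π x : H →L[ℂ] H) g) (u n) :=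
    ae_all_iff.2 fun n => (hg (u n)).coeFn_toLp
  have h2 : ∀ᵐ x ∂μ, (V₀ f : G → ℂ) x = inner ℂ ((π x : H →L[ℂ] H) g) f := (hg f).coeFn_toLp
  refine Lp.ext ?_
  filter_upwards [hae, h1, h2] with x hx h1x h2x
  rw [h2x]
  refine tendsto_nhds_unique hx ?_
  simp only [Function.comp_apply, h1x]
  exact (Filter.Tendsto.inner tendsto_const_nhds (hu.comp hφ.tendsto_atTop))

omit [Group G] in
theorem lintegral_enorm_sq_eq_eLpNorm (F : G → ℂ) :
    ∫⁻ x, ‖F x‖ₑ ^ 2 ∂μ = eLpNorm F 2 μ ^ 2 := by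
  have := eLpNorm_nnreal_pow_eq_lintegral (μ := μ) (f := F) (p := 2) two_ne_zero
  simpa using this.symm

/-- By left invariance of `μ`, `V*V` commutes with `π` for the coefficient operator `V`; Schur's
lemma makes `‖V f‖²` a multiple of `‖f‖²`. -/
theorem IsIrreducible.exists_lintegral_eq [MeasurableMul G] [μ.IsMulLeftInvariant] [Nontrivial H]
    (hi : IsIrreducible π) (hπ : IsProjectiveRep σ π) {g : H}
    (hg : ∀ f, MemLp (fun x => inner ℂ ((π x : H →L[ℂ] H) g) f) 2 μ) :
    ∃ c : ℝ, 0 ≤ c ∧ ∀ f, ∫⁻ x, ‖inner ℂ ((π x : H →L[ℂ] H) g) f‖ₑ ^ 2 ∂μ =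
      ENNReal.ofReal (c * ‖f‖ ^ 2) := by
  obtain ⟨V, hV⟩ := exists_coefficient_operator hg
  have hVae : ∀ f, ∀ᵐ x ∂μ, (V f : G → ℂ) x = inner ℂ ((π x : H →L[ℂ] H) g) f := fun f => by
    rw [hV]; exact (hg f).coeFn_toLp
  have hVi : ∀ f₁ f₂, inner ℂ (V f₁) (V f₂) = ∫ x, inner ℂ (inner ℂ ((π x : H →L[ℂ] H) g) f₁)
      (inner ℂ ((π x : H →L[ℂ] H) g) f₂) ∂μ := by
    intro f₁ f₂
    rw [L2.inner_def]
    refine integral_congr_ae ?_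
    filter_upwards [hVae f₁, hVae f₂] with x h1 h2
    rw [h1, h2]
  have hinv : ∀ y f₁ f₂, inner ℂ (V ((π y : H →L[ℂ] H) f₁)) (V ((π y : H →L[ℂ] H) f₂)) =
      inner ℂ (V f₁) (V f₂) := by
    intro y f₁ f₂
    rw [hVi, hVi, ← integral_mul_left_eq_self _ y]
    refine integral_congr_ae (Filter.Eventually.of_forall fun x => ?_)
    have hs : (σ y x : ℂ) * starRingEnd ℂ (σ y x : ℂ) = 1 := by
      rw [Complex.mul_conj, Complex.normSq_eq_norm_sq, Circle.norm_coe]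
      simp
    simp only [hπ.isAlgProjectiveRep.inner_mul_apply, RCLike.inner_apply, map_mul]
    linear_combination (inner ℂ ((π x : H →L[ℂ] H) g) f₂ *
      starRingEnd ℂ (inner ℂ ((π x : H →L[ℂ] H) g) f₁)) * hs
  have hcomm : ∀ y, Commute (V.adjoint ∘L V) (π y : H →L[ℂ] H) := by
    intro y
    ext f
    change V.adjoint (V ((π y : H →L[ℂ] H) f)) = (π y : H →L[ℂ] H) (V.adjoint (V f))
    apply ext_inner_right ℂ
    intro w
    obtain ⟨w, rfl⟩ := (Unitary.linearIsometryEquiv (π y)).surjective w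
    rw [ContinuousLinearMap.adjoint_inner_left]
    refine (hinv y f w).trans ?_
    refine Eq.trans ?_ (inner_unitary_unitary _ _ _).symm
    rw [ContinuousLinearMap.adjoint_inner_left]
  obtain ⟨c, hc⟩ := hi.exists_re_inner_eq
    (ContinuousLinearMap.isPositive_adjoint_comp_self V).isSelfAdjoint hcomm
  have hVn : ∀ f, ‖V f‖ ^ 2 = c * ‖f‖ ^ 2 := by
    intro f
    rw [← hc, ContinuousLinearMap.comp_apply, ContinuousLinearMap.adjoint_inner_left,
      inner_self_eq_norm_sq_to_K]
    norm_cast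
  refine ⟨c, ?_, fun f => ?_⟩
  · obtain ⟨e, he⟩ := exists_norm_eq H zero_le_one
    have := hVn e
    rw [he, one_pow, mul_one] at this
    rw [← this]
    positivity
  · rw [lintegral_enorm_sq_eq_eLpNorm, ← Lp.enorm_toLp (hg f), ← hV, ← hVn,
      ENNReal.ofReal_pow (norm_nonneg _), ofReal_norm]

theorem IsProjectiveRep.lintegral_symm [MeasurableInv G] [μ.IsInvInvariant]
    (hπ : IsProjectiveRep σ π) (f g : H) :
    ∫⁻ x, ‖inner ℂ ((π x : H →L[ℂ] H) g) f‖ₑ ^ 2 ∂μ =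
      ∫⁻ x, ‖inner ℂ ((π x : H →L[ℂ] H) f) g‖ₑ ^ 2 ∂μ := by
  rw [← lintegral_inv_eq_self]
  refine lintegral_congr fun x => ?_
  rw [← ofReal_norm, ← ofReal_norm, ← hπ.isAlgProjectiveRep.norm_inner_apply, norm_inner_symm]

/-- The integral is `c_g ‖f‖²`. It is symmetric in `f` and `g` by inversion invariance, so
comparison with a fixed `f₀ ∈ D` shows `c_g` proportional to `‖g‖²`. -/
theorem IsProjectiveRep.exists_lintegral_eq [MeasurableMul G] [MeasurableInv G]
    [μ.IsMulLeftInvariant] [μ.IsInvInvariant] [Nontrivial H]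
    (hi : IsIrreducible π) (hπ : IsProjectiveRep σ π) {D : Submodule ℂ H} (hD : D ≠ ⊥)
    (h : ∀ f : H, ∀ g ∈ D, MemLp (fun x => inner ℂ ((π x : H →L[ℂ] H) g) f) 2 μ) :
    ∃ κ : ℝ, 0 ≤ κ ∧ ∀ f, ∀ g ∈ D, ∫⁻ x, ‖inner ℂ ((π x : H →L[ℂ] H) g) f‖ₑ ^ 2 ∂μ =
      ENNReal.ofReal (κ * ‖f‖ ^ 2 * ‖g‖ ^ 2) := by
  obtain ⟨f₀, hf₀, hne⟩ := D.exists_mem_ne_zero_of_ne_bot hD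
  have hpos : 0 < ‖f₀‖ := norm_pos_iff.2 hne
  obtain ⟨c₀, hc₀, h₀⟩ := hi.exists_lintegral_eq hπ fun f => h f f₀ hf₀
  refine ⟨c₀ / ‖f₀‖ ^ 2, by positivity, fun f g hg => ?_⟩
  obtain ⟨c, hc, h₁⟩ := hi.exists_lintegral_eq hπ fun f => h f g hg
  have h2 := h₁ f₀
  rw [hπ.lintegral_symm, h₀, ENNReal.ofReal_eq_ofReal_iff (by positivity) (by positivity)] at h2
  rw [h₁]
  congr 1
  field_simp
  linear_combination (-‖f‖ ^ 2) * h2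

/-- Approximate `g` by vectors of `D`: the formula for the integral on `D` is continuous in `g`, so
Fatou's lemma bounds the limit. -/
theorem IsSquareIntegrable.memLp [MeasurableMul G] [MeasurableInv G]
    [μ.IsMulLeftInvariant] [μ.IsInvInvariant] [Nontrivial H]
    (hi : IsIrreducible π) (hπ : IsProjectiveRep σ π) (hs : IsSquareIntegrable μ π) (f g : H) :
    MemLp (fun x => inner ℂ ((π x : H →L[ℂ] H) g) f) 2 μ := by
  obtain ⟨D, hD, h⟩ := hs
  have hbot : D ≠ ⊥ := by
    rintro rfl
    rw [Submodule.dense_iff_topologicalClosure_eq_top] at hD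
    have h0 : (⊥ : Submodule ℂ H).topologicalClosure = ⊥ :=
      IsClosed.submodule_topologicalClosure_eq (by simp)
    rw [h0] at hD
    exact bot_ne_top hD
  obtain ⟨κ, hκ, hJ⟩ := hπ.exists_lintegral_eq hi hbot h
  have hmeas : ∀ g, Measurable fun x => inner ℂ ((π x : H →L[ℂ] H) g) f := fun g => by
    have := Complex.continuous_conj.measurable.comp (hπ.weakly_measurable g f)
    simpa [Function.comp_def, inner_conj_symm] using this
  obtain ⟨u, huD, hu⟩ := mem_closure_iff_seq_limit.1 (hD g)
  have hle : ∫⁻ x, ‖inner ℂ ((π x : H →L[ℂ] H) g) f‖ₑ ^ 2 ∂μ ≤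
      ENNReal.ofReal (κ * ‖f‖ ^ 2 * ‖g‖ ^ 2) := by
    have h1 : ∀ x, Filter.liminf (fun n => ‖inner ℂ ((π x : H →L[ℂ] H) (u n)) f‖ₑ ^ 2)
        Filter.atTop = ‖inner ℂ ((π x : H →L[ℂ] H) g) f‖ₑ ^ 2 := fun x => by
      apply Filter.Tendsto.liminf_eq
      have h3 : Continuous fun w => ‖inner ℂ ((π x : H →L[ℂ] H) w) f‖ₑ ^ 2 := by fun_prop
      exact (h3.tendsto g).comp hu
    have h2 : Filter.liminf (fun n => ∫⁻ x, ‖inner ℂ ((π x : H →L[ℂ] H) (u n)) f‖ₑ ^ 2 ∂μ)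
        Filter.atTop = ENNReal.ofReal (κ * ‖f‖ ^ 2 * ‖g‖ ^ 2) := by
      apply Filter.Tendsto.liminf_eq
      simp only [hJ f _ (huD _)]
      have h3 : Continuous fun w : H => ENNReal.ofReal (κ * ‖f‖ ^ 2 * ‖w‖ ^ 2) :=
        ENNReal.continuous_ofReal.comp (by fun_prop)
      exact (h3.tendsto g).comp hu
    rw [← h2]
    simp only [← h1]
    exact lintegral_liminf_le fun n => (hmeas (u n)).enorm.pow_const 2
  refine ⟨(hmeas g).aestronglyMeasurable, ?_⟩
  rw [lintegral_enorm_sq_eq_eLpNorm] at hle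
  have := hle.trans_lt ENNReal.ofReal_lt_top
  exact (ENNReal.pow_lt_top_iff.1 this).resolve_right two_ne_zero

end Coefficients

/-! ### Orthogonality relations by polarization. -/

section Orthogonality

/-- A sesquilinear form vanishing on the diagonal vanishes. -/
theorem eq_zero_of_sesquilinear_of_diagonal {H : Type*} [AddCommGroup H] [Module ℂ H]
    {B : H → H → ℂ} (add_left : ∀ a b c, B (a + b) c = B a c + B b c)
    (smul_left : ∀ (r : ℂ) a c, B (r • a) c = r * B a c)
    (add_right : ∀ a b c, B a (b + c) = B a b + B a c)
    (smul_right : ∀ (r : ℂ) a c, B a (r • c) = starRingEnd ℂ r * B a c)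
    (diag : ∀ a, B a a = 0) (a b : H) : B a b = 0 := by
  have h1 := diag (a + b)
  have h2 := diag (a + Complex.I • b)
  simp only [add_left, add_right, smul_left, smul_right, diag, Complex.conj_I] at h1 h2
  have h3 : Complex.I * (B b a - B a b) = 0 := by linear_combination h2
  have h4 := (mul_eq_zero.1 h3).resolve_left Complex.I_ne_zero
  linear_combination (1 / 2 : ℂ) * h1 - (1 / 2 : ℂ) * h4

variable {G : Type*} [Group G] [MeasurableSpace G] {μ : Measure G}
  {H : Type*} [NormedAddCommGroup H] [InnerProductSpace ℂ H] [CompleteSpace H]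
  {σ : G → G → Circle} {π : G → unitary (H →L[ℂ] H)}

/-- Otherwise, testing against a countable dense set, `π(x) f = 0` for some `x`, although `π(x)` is
unitary. -/
theorem IsProjectiveRep.exists_enorm_inner_ne_zero [TopologicalSpace.SeparableSpace H]
    [Nontrivial H] [NeZero μ] (hπ : IsProjectiveRep σ π) :
    ∃ f g : H, ∫⁻ x, ‖inner ℂ g ((π x : H →L[ℂ] H) f)‖ₑ ^ 2 ∂μ ≠ 0 := by
  by_contra! hall
  obtain ⟨f, hf⟩ := exists_norm_eq H zero_le_one
  have hae : ∀ᵐ x ∂μ, ∀ n, inner ℂ (TopologicalSpace.denseSeq H n) ((π x : H →L[ℂ] H) f) = 0 := by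
    rw [ae_all_iff]
    intro n
    have := (lintegral_eq_zero_iff (hπ.measurable_enorm_inner_sq f _)).1
      (hall f (TopologicalSpace.denseSeq H n))
    filter_upwards [this] with x hx
    simpa using hx
  obtain ⟨x, hx⟩ := hae.exists
  have h0 : (π x : H →L[ℂ] H) f = 0 :=
    (TopologicalSpace.denseRange_denseSeq H).eq_zero_of_inner_right ℂ hx
  have := norm_unitary_apply (π x) f
  rw [h0, norm_zero, hf] at this
  exact zero_ne_one this

omit [Group G] in
theorem isFormalDimension_of_lintegral_eq {κ : ℝ} (hκ : 0 < κ)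
    (hmem : ∀ f g, MemLp (fun x => inner ℂ g ((π x : H →L[ℂ] H) f)) 2 μ)
    (h : ∀ f g, ∫⁻ x, ‖inner ℂ g ((π x : H →L[ℂ] H) f)‖ₑ ^ 2 ∂μ =
      ENNReal.ofReal (κ * ‖f‖ ^ 2 * ‖g‖ ^ 2)) : IsFormalDimension μ π κ⁻¹ := by
  set Φ : H → H → H → H → ℂ := fun f₁ f₂ g₁ g₂ => ∫ x, inner ℂ g₁ ((π x : H →L[ℂ] H) f₁) *
    starRingEnd ℂ (inner ℂ g₂ ((π x : H →L[ℂ] H) f₂)) ∂μ with hΦ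
  have hint : ∀ f₁ f₂ g₁ g₂, Integrable (fun x => inner ℂ g₁ ((π x : H →L[ℂ] H) f₁) *
      starRingEnd ℂ (inner ℂ g₂ ((π x : H →L[ℂ] H) f₂))) μ := fun f₁ f₂ g₁ g₂ =>
    (hmem f₁ g₁).integrable_mul (hmem f₂ g₂).star
  have hdiag : ∀ f g, Φ f f g g = κ * ‖f‖ ^ 2 * ‖g‖ ^ 2 := by
    intro f g
    have h1 : ∀ x, inner ℂ g ((π x : H →L[ℂ] H) f) *
        starRingEnd ℂ (inner ℂ g ((π x : H →L[ℂ] H) f)) =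
          ((‖inner ℂ g ((π x : H →L[ℂ] H) f)‖ ^ 2 : ℝ) : ℂ) := fun x => by
      rw [Complex.mul_conj, Complex.normSq_eq_norm_sq]
    have h2 : ∫ x, ‖inner ℂ g ((π x : H →L[ℂ] H) f)‖ ^ 2 ∂μ = κ * ‖f‖ ^ 2 * ‖g‖ ^ 2 := by
      rw [integral_eq_lintegral_of_nonneg_ae (Filter.Eventually.of_forall fun x => sq_nonneg _)
        ((hmem f g).aestronglyMeasurable.norm.pow 2)]
      have h3 : ∀ x, ENNReal.ofReal (‖inner ℂ g ((π x : H →L[ℂ] H) f)‖ ^ 2) =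
          ‖inner ℂ g ((π x : H →L[ℂ] H) f)‖ₑ ^ 2 := fun x => by
        rw [ENNReal.ofReal_pow (norm_nonneg _), ofReal_norm]
      simp only [h3, h]
      exact ENNReal.toReal_ofReal (by positivity)
    simp only [hΦ, h1]
    rw [integral_complex_ofReal, h2]
    norm_cast
  have haf1 : ∀ a b f₂ g₁ g₂, Φ (a + b) f₂ g₁ g₂ = Φ a f₂ g₁ g₂ + Φ b f₂ g₁ g₂ := by
    intro a b f₂ g₁ g₂
    simp only [hΦ]
    rw [← integral_add (hint _ _ _ _) (hint _ _ _ _)]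
    simp only [map_add, inner_add_right, add_mul]
  have haf2 : ∀ f₁ a b g₁ g₂, Φ f₁ (a + b) g₁ g₂ = Φ f₁ a g₁ g₂ + Φ f₁ b g₁ g₂ := by
    intro f₁ a b g₁ g₂
    simp only [hΦ]
    rw [← integral_add (hint _ _ _ _) (hint _ _ _ _)]
    simp only [map_add, inner_add_right, mul_add]
  have hag1 : ∀ f₁ f₂ a b g₂, Φ f₁ f₂ (a + b) g₂ = Φ f₁ f₂ a g₂ + Φ f₁ f₂ b g₂ := by
    intro f₁ f₂ a b g₂
    simp only [hΦ]
    rw [← integral_add (hint _ _ _ _) (hint _ _ _ _)]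
    simp only [inner_add_left, add_mul]
  have hag2 : ∀ f₁ f₂ g₁ a b, Φ f₁ f₂ g₁ (a + b) = Φ f₁ f₂ g₁ a + Φ f₁ f₂ g₁ b := by
    intro f₁ f₂ g₁ a b
    simp only [hΦ]
    rw [← integral_add (hint _ _ _ _) (hint _ _ _ _)]
    simp only [inner_add_left, map_add, mul_add]
  have hsf1 : ∀ (r : ℂ) f₁ f₂ g₁ g₂, Φ (r • f₁) f₂ g₁ g₂ = r * Φ f₁ f₂ g₁ g₂ := by
    intro r f₁ f₂ g₁ g₂
    simp only [hΦ, ← integral_const_mul, map_smul, inner_smul_right, mul_assoc]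
  have hsf2 : ∀ (r : ℂ) f₁ f₂ g₁ g₂,
      Φ f₁ (r • f₂) g₁ g₂ = starRingEnd ℂ r * Φ f₁ f₂ g₁ g₂ := by
    intro r f₁ f₂ g₁ g₂
    simp only [hΦ, ← integral_const_mul, map_smul, inner_smul_right, map_mul, mul_left_comm]
  have hsg1 : ∀ (r : ℂ) f₁ f₂ g₁ g₂,
      Φ f₁ f₂ (r • g₁) g₂ = starRingEnd ℂ r * Φ f₁ f₂ g₁ g₂ := by
    intro r f₁ f₂ g₁ g₂
    simp only [hΦ, ← integral_const_mul, inner_smul_left, mul_assoc]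
  have hsg2 : ∀ (r : ℂ) f₁ f₂ g₁ g₂, Φ f₁ f₂ g₁ (r • g₂) = r * Φ f₁ f₂ g₁ g₂ := by
    intro r f₁ f₂ g₁ g₂
    simp only [hΦ, ← integral_const_mul, inner_smul_left, map_mul, Complex.conj_conj,
      mul_left_comm]
  have hpol1 : ∀ f₁ f₂ g, Φ f₁ f₂ g g = κ * inner ℂ f₂ f₁ * ‖g‖ ^ 2 := by
    intro f₁ f₂ g
    refine sub_eq_zero.1 (eq_zero_of_sesquilinear_of_diagonal
      (B := fun f₁ f₂ => Φ f₁ f₂ g g - κ * inner ℂ f₂ f₁ * ‖g‖ ^ 2) ?_ ?_ ?_ ?_ ?_ f₁ f₂)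
    · intro a b c; simp only [haf1, inner_add_right]; ring
    · intro r a c; simp only [hsf1, inner_smul_right]; ring
    · intro a b c; simp only [haf2, inner_add_left]; ring
    · intro r a c; simp only [hsf2, inner_smul_left]; ring
    · intro a
      simp only [hdiag, inner_self_eq_norm_sq_to_K]
      exact sub_self _
  have hpol2 : ∀ f₁ f₂ g₁ g₂,
      Φ f₁ f₂ g₁ g₂ = κ * inner ℂ f₂ f₁ * starRingEnd ℂ (inner ℂ g₂ g₁) := by
    intro f₁ f₂ g₁ g₂
    -- The order `g₂, g₁` is deliberate: the integral is linear in `g₂` and conjugate-linear in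
    -- `g₁`.
    refine sub_eq_zero.1 (eq_zero_of_sesquilinear_of_diagonal
      (B := fun g₂ g₁ => Φ f₁ f₂ g₁ g₂ - κ * inner ℂ f₂ f₁ * starRingEnd ℂ (inner ℂ g₂ g₁))
      ?_ ?_ ?_ ?_ ?_ g₂ g₁)
    · intro a b c; simp only [hag2, inner_add_left, map_add]; ring
    · intro r a c; simp only [hsg2, inner_smul_left, map_mul, Complex.conj_conj]; ring
    · intro a b c; simp only [hag1, inner_add_right, map_add]; ring
    · intro r a c; simp only [hsg1, inner_smul_right, map_mul]; ring
    · intro a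
      simp only [hpol1]
      rw [inner_conj_symm, inner_self_eq_norm_sq_to_K]
      exact sub_self _
  refine ⟨inv_pos.2 hκ, fun f₁ f₂ g₁ g₂ => ⟨hint f₁ f₂ g₁ g₂, ?_⟩⟩
  rw [Complex.ofReal_inv, inv_inv]
  exact hpol2 f₁ f₂ g₁ g₂

/-- The orthogonality relations for discrete series representations of unimodular groups. -/
theorem IsDiscreteSeries.existsUnique_formalDimension [MeasurableMul G] [MeasurableInv G]
    [μ.IsMulLeftInvariant] [μ.IsInvInvariant] [NeZero μ] [TopologicalSpace.SeparableSpace H]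
    [Nontrivial H] (hπ : IsDiscreteSeries μ σ π) : ∃! d : ℝ, IsFormalDimension μ π d := by
  obtain ⟨hp, hs, hi⟩ := hπ
  have hmem := hs.memLp hi hp
  obtain ⟨κ, hκ, hJ⟩ := hp.exists_lintegral_eq (μ := μ) hi (D := ⊤) top_ne_bot
    (fun f g _ => hmem f g)
  have hJ' : ∀ f g, ∫⁻ x, ‖inner ℂ g ((π x : H →L[ℂ] H) f)‖ₑ ^ 2 ∂μ =
      ENNReal.ofReal (κ * ‖f‖ ^ 2 * ‖g‖ ^ 2) := by
    intro f g
    rw [mul_right_comm, ← hJ g f trivial]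
    refine lintegral_congr fun x => ?_
    rw [← ofReal_norm, ← ofReal_norm, norm_inner_symm]
  have hκ' : 0 < κ := by
    obtain ⟨f, g, hfg⟩ := hp.exists_enorm_inner_ne_zero (μ := μ)
    refine hκ.lt_of_ne' ?_
    rintro rfl
    simp [hJ'] at hfg
  refine ⟨κ⁻¹, isFormalDimension_of_lintegral_eq hκ' (fun f g => ?_) hJ', fun d hd => ?_⟩
  · have := (hmem g f).star
    refine this.ae_eq (Filter.Eventually.of_forall fun x => ?_)
    exact inner_conj_symm _ _
  · obtain ⟨e, he⟩ := exists_norm_eq H zero_le_one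
    have h := hd.lintegral_enorm_inner_sq e e
    have hd0 := hd.1
    rw [hJ', he, one_pow, mul_one, mul_one, mul_one, mul_one,
      ENNReal.ofReal_eq_ofReal_iff hκ (by positivity)] at h
    rw [h, inv_inv]

end Orthogonality

end LatticeOrbits

/-! ### The density theorem. -/

open LatticeOrbits in
theorem mainTheorem4
    {G : Type*} [Group G] [TopologicalSpace G] [IsTopologicalGroup G] [T2Space G]
    [LocallyCompactSpace G] [SecondCountableTopology G] [MeasurableSpace G] [BorelSpace G]
    (μ : Measure G) [μ.IsHaarMeasure] [μ.IsMulRightInvariant]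
    {H : Type*} [NormedAddCommGroup H] [InnerProductSpace ℂ H] [CompleteSpace H]
    [TopologicalSpace.SeparableSpace H] [Nontrivial H]
    (Γ : Subgroup G) (hΓ : IsLattice μ Γ)
    (σ : G → G → Circle) (π : G → unitary (H →L[ℂ] H)) (hπ : IsDiscreteSeries μ σ π) :
    (∃! v : ℝ, IsCovolume μ Γ v) ∧
    (∃! d : ℝ, IsFormalDimension μ π d) ∧
    ∀ v d : ℝ, IsCovolume μ Γ v → IsFormalDimension μ π d →
      ((∃ g : H, IsCyclicVector (fun γ : Γ => π γ) g) → v * d ≤ 1) ∧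
      ((∃ g : H, IsFrameVector (fun γ : Γ => π γ) g) → v * d ≤ 1) ∧
      ((∃ g : H, IsRieszVector (fun γ : Γ => π γ) g) → 1 ≤ v * d) ∧
      (KleppnerCondition (fun γ γ' : Γ => σ γ γ') →
        (∃ g : H, IsSeparatingVector (fun γ : Γ => π γ) g) → 1 ≤ v * d) := by
  have := isInvInvariant_of_isMulRightInvariant μ
  refine ⟨hΓ.existsUnique_covolume, hπ.existsUnique_formalDimension, fun v d hv hd => ?_⟩
  have := hΓ.countable
  have hp := hπ.isProjectiveRep
  have hpΓ := hp.isAlgProjectiveRep_subgroup Γ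
  obtain ⟨Ω, hΩ, hΩv⟩ := hv.exists_isLeftFundamentalDomain
  have hdom := hd.dense_coefficientDomain hp hΩ
  have hcyc : (∃ g : H, IsCyclicVector (fun γ : Γ => π γ) g) → v * d ≤ 1 := by
    rintro ⟨g, hg⟩
    obtain ⟨e, he, hf⟩ := hpΓ.exists_parseval_vector (hdom g) hg
    exact hd.covolume_mul_le_one hp hΩ hv.1 hΩv he hf
  refine ⟨hcyc, ?_, ?_, ?_⟩
  · rintro ⟨g, hg⟩
    exact hcyc ⟨g, hg.isCyclicVector⟩
  · rintro ⟨g, hg⟩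
    obtain ⟨D, hD, hinj⟩ := hg.exists_synthesis
    obtain ⟨e, he, hf⟩ := hpΓ.exists_bessel_unit_vector hD hinj
    exact hd.one_le_covolume_mul hp hΩ hv.1 hΩv he hf
  · rintro hσ ⟨g, hg⟩
    obtain ⟨h, hinj⟩ := hpΓ.exists_injective_synthesis hσ hdom
      (hd.norm_le_of_adjoint_synthesis_le hp hΩ) hg
    obtain ⟨e, he, hf⟩ := hpΓ.exists_bessel_unit_vector (synthesis_delta h) hinj
    exact hd.one_le_covolume_mul hp hΩ hv.1 hΩv he hf
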